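/- Let $s\ge 2$ and let $n,k$ be positive integers with $k\mid n$ or $n\mid k$. Let $\Sigma=\{0,\dots,s-1\}$. A necklace is an equivalence class of words under rotation. It is $(n,k)$-perfect if every word of length $n$ occurs in it (circularly) exactly $k$ times, at positions that are pairwise incongruent modulo $k$, for any choice of the starting position. Necklaces are compared lexicographically through their lexicographically greatest rotations. Order $\Sigma^n\times\mathbb Z_k$ by $\langle A,u\rangle\succ\langle B,v\rangle$ if $u<v$ in $\{0,\dots,k-1\}$, or $u=v$ and $A>B$ lexicographically. The right rotation of $\langle a_1\dots a_n,u\rangle$ is $\langle a_2\dots a_na_1,u+1\rangle$, and a pair is maximal if it is the $\succ$-greatest among its iterated rotations. If $k\mid n$, the reduction of $\langle A,u\rangle$ is $\langle a_1\dots a_p,u\rangle$, where $p$ is the smallest integer with $k\mid p$, $p\mid n$ and $A=(a_1\dots a_p)^{n/p}$. If $n\mid k$, the expansion of $\langle A,u\rangle$ is $\langle A^{k/n},u\rangle$. The Lyndon pairs are the reductions of the maximal pairs if $k\mid n$, and the expansions of the maximal pairs if $n\mid k$, $n<k$. List the Lyndon pairs in the $\succ$-decreasing order of the maximal pairs from which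 they come, and let $X$ be the concatenation of their words in this order. Then $X$ has length $s^nk$, the necklace of $X$ is $(n,k)$-perfect, $X$ is its lexicographically greatest rotation, and the necklace of $X$ is lexicographically greater than every other $(n,k)$-perfect necklace. For $k=1$ this is the Fredricksen–Maiorana construction of the greatest de Bruijn necklace of order $n$: the words concatenated are exactly the Lyndon words (nonempty words strictly greater than all their nontrivial rotations) whose length divides $n$, each once, with $v$ before $w$ when $v^{n/|v|}>w^{n/|w|}$ lexicographically. -/

import Mathlib

/-- Words of length `n` over the alphabet `{0, …, s - 1}`. -/
abbrev Word (s n : ℕ) : Type := Fin n → Fin s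

/-- The pairs `⟨A, u⟩` in `Σ^n × ℤ_k`. -/
abbrev WordPair (s n k : ℕ) : Type := Word s n × ZMod k

namespace WordPair

variable {s n k : ℕ}

/-- `P ≻ Q`: the smaller the second component in `{0, …, k - 1}`, the greater the pair; pairs with
the same second component are compared by the lexicographic order of their words. -/
def Succ (P Q : WordPair s n k) : Prop :=
  (List.ofFn Q.1 < List.ofFn P.1 ∧ P.2 = Q.2) ∨ P.2.val < Q.2.val

/-- `P ≽ Q`. -/
def SuccEq (P Q : WordPair s n k) : Prop := P.Succ Q ∨ P = Q

instance : DecidableRel (Succ (s := s) (n := n) (k := k)) := fun P Q => by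
  unfold Succ; infer_instance

instance : DecidableRel (SuccEq (s := s) (n := n) (k := k)) := fun P Q => by
  unfold SuccEq; infer_instance

/-- The right rotation `⟨a₁ … aₙ, u⟩ ↦ ⟨a₂ … aₙ a₁, u + 1⟩`. -/
def rotate (P : WordPair s n k) : WordPair s n k := (P.1 ∘ finRotate n, P.2 + 1)

/-- The set of pairs that are equivalent to `P` under rotations. -/
def rotations (P : WordPair s n k) : Set (WordPair s n k) :=
  {Q | ∃ i < max n k, Q = rotate^[i] P}

/-- `P` is the greatest pair, in the order `≻`, among its rotations. -/
def IsMaximal (P : WordPair s n k) : Prop := ∀ Q ∈ P.rotations, P.SuccEq Q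

theorem Succ.trans {P Q R : WordPair s n k} (h : P.Succ Q) (h' : Q.Succ R) : P.Succ R := by
  rcases h with ⟨h1, h2⟩ | h <;> rcases h' with ⟨h3, h4⟩ | h'
  · exact Or.inl ⟨h3.trans h1, h2.trans h4⟩
  · exact Or.inr (by rw [h2]; exact h')
  · exact Or.inr (by rw [← h4]; exact h)
  · exact Or.inr (h.trans h')

theorem Succ.irrefl (P : WordPair s n k) : ¬ P.Succ P := by
  rintro (⟨h, -⟩ | h)
  · exact lt_irrefl _ h
  · exact lt_irrefl _ h

instance : IsTrans (WordPair s n k) SuccEq where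
  trans P Q R h h' := by
    rcases h with h | rfl
    · rcases h' with h' | rfl
      · exact Or.inl (h.trans h')
      · exact Or.inl h
    · exact h'

instance : Std.Antisymm (SuccEq (s := s) (n := n) (k := k)) where
  antisymm P Q h h' := by
    rcases h with h | h
    · rcases h' with h' | h'
      · exact (Succ.irrefl _ (h.trans h')).elim
      · exact h'.symm
    · exact h

instance [NeZero k] : Std.Total (SuccEq (s := s) (n := n) (k := k)) where
  total P Q := by
    rcases lt_trichotomy P.2.val Q.2.val with h | h | h
    · exact Or.inl (Or.inl (Or.inr h))
    · have h2 : P.2 = Q.2 := ZMod.val_injective k h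
      rcases lt_trichotomy (List.ofFn P.1) (List.ofFn Q.1) with h1 | h1 | h1
      · exact Or.inr (Or.inl (Or.inl ⟨h1, h2.symm⟩))
      · exact Or.inl (Or.inr (Prod.ext (List.ofFn_injective h1) h2))
      · exact Or.inl (Or.inl (Or.inl ⟨h1, h2⟩))
    · exact Or.inr (Or.inl (Or.inr h))

end WordPair

/-- The word `w ^ m`, made of `m` copies of `w`. -/
def wordPow {s : ℕ} (w : List (Fin s)) (m : ℕ) : List (Fin s) := (List.replicate m w).flatten

/-- The length of the reduction of `A`: the smallest `p` such that `k ∣ p`, `p ∣ n` and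
`A = (a₁ … a_p)^(n / p)`. When `k ∣ n` such a `p` exists. -/
noncomputable def reductionLength {s n : ℕ} (k : ℕ) (A : Word s n) : ℕ :=
  sInf {p : ℕ | k ∣ p ∧ p ∣ n ∧ List.ofFn A = wordPow ((List.ofFn A).take p) (n / p)}

/-- The reduction of `A` (for `k ∣ n`). -/
noncomputable def reduction {s n : ℕ} (k : ℕ) (A : Word s n) : List (Fin s) :=
  (List.ofFn A).take (reductionLength k A)

/-- The expansion of `A` (for `n ∣ k`). -/
def expansion {s n : ℕ} (k : ℕ) (A : Word s n) : List (Fin s) := wordPow (List.ofFn A) (k / n)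

/-- The Lyndon pair of a maximal pair: its reduction when `k ∣ n`, and its expansion when `n ∣ k`
with `n < k`. -/
noncomputable def lyndonPair {s n k : ℕ} (P : WordPair s n k) : List (Fin s) × ZMod k :=
  if k ∣ n then (reduction k P.1, P.2) else (expansion k P.1, P.2)

open Classical in
/-- The list of all maximal pairs in `Σ^n × ℤ_k`, in `≻`-decreasing order. -/
noncomputable def maximalPairs (s n k : ℕ) [NeZero k] : List (WordPair s n k) :=
  (Finset.univ.filter fun P : WordPair s n k => P.IsMaximal).sort WordPair.SuccEq

/-- The list of the Lyndon pairs, in the order of the maximal pairs that they come from. -/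
noncomputable def lyndonPairs (s n k : ℕ) [NeZero k] : List (List (Fin s) × ZMod k) :=
  (maximalPairs s n k).map lyndonPair

/-- The words of the Lyndon pairs, in the same order. -/
noncomputable def lyndonPairWords (s n k : ℕ) [NeZero k] : List (List (Fin s)) :=
  (lyndonPairs s n k).map Prod.fst

/-- The concatenation of the words of the Lyndon pairs. -/
noncomputable def lyndonConcat (s n k : ℕ) [NeZero k] : List (Fin s) :=
  (lyndonPairWords s n k).flatten

/-- The positions (numbered from `0`) of the circular word `w` at which `A` occurs. -/
def occurrences {s n : ℕ} (w : List (Fin s)) (A : Word s n) : Finset ℕ :=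
  (Finset.range w.length).filter fun i => ∀ j : Fin n, w[(i + j) % w.length]? = some (A j)

/-- A necklace (an equivalence class of words under rotation) is `(n, k)`-perfect if every word of
length `n` occurs exactly `k` times, at positions that are pairwise different modulo `k`, for every
choice of the starting position. -/
def IsPerfect {s : ℕ} (n k : ℕ) (c : Cycle (Fin s)) : Prop :=
  ∀ w : List (Fin s), (w : Cycle (Fin s)) = c → ∀ A : Word s n,
    (occurrences w A).card = k ∧ Set.InjOn (fun i : ℕ => i % k) (occurrences w A)

/-- `w` is the lexicographically greatest of the words that represent the necklace `c`. -/
def IsMaxRotation {s : ℕ} (w : List (Fin s)) (c : Cycle (Fin s)) : Prop :=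
  IsGreatest {v : List (Fin s) | (v : Cycle (Fin s)) = c} w

/-- The necklace `c` is lexicographically greater than the necklace `d`: necklaces are compared
through their greatest rotations. -/
def NecklaceGT {s : ℕ} (c d : Cycle (Fin s)) : Prop :=
  ∃ v w : List (Fin s), IsMaxRotation v c ∧ IsMaxRotation w d ∧ w < v

/-- A Lyndon word: nonempty and strictly greater than its nontrivial rotations (which forces it to
be aperiodic). -/
def IsLyndonWord {s : ℕ} (w : List (Fin s)) : Prop :=
  w ≠ [] ∧ ∀ i, 0 < i → i < w.length → w.rotate i < w

/-!
Let `M₀ > M₁ > … > M_{m-1} = 0…0` be the maximal words (those that are at least as large as all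
their rotations by multiples of `k`), and let `R_i` be the word of the Lyndon pair of `⟨M_i, 0⟩`.
In both cases `R_i` is the prefix of `M_i M_i M_i …` whose length is the number of different
rotations of the pair `⟨M_i, 0⟩` (`lyndonPair_fst`), so the length of `X = R₀ R₁ …` is the number of
pairs.

The main fact about maximal words is `Word.Maximal.update_zero`: a maximal word stays maximal when
its last nonzero letter is replaced by `0`. Hence `M_{i+1}` agrees with `M_i` before the last
nonzero letter of `M_i`, and by downward induction `X`, read from the start of `R_i`, agrees with
`M_i M_i …` for `|R_i| + j` letters, where `j` is the position of that letter, numbered from `0`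
(`lyndonSeq_start_add`).

*Perfectness.* It suffices that every pair `⟨W, ρ⟩` occurs, by counting. It is the `r`-th rotation
of some `⟨M_i, 0⟩` with `r < |R_i|`. If `M_i ≠ 0…0`, then `W` can be read at distance `r` from the
start of `R_i` unless `M_i = B 0^t` and `W = 0^t B` with `t = |R_i| - r`. In that case `W` straddles
the start of the word that comes from the greatest maximal word with prefix `B`, because the maximal
word before that one has no nonzero letter beyond the length of `B`
(`exists_occurrence_zeros_append`). The word `0…0` is covered by the same lemma with a suitable `t`,
or lies inside the last block.

*Maximality.* Suppose that a perfect word `w` is greater than `X`, with first difference inside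
`R_h`. Let `k ∣ n` and `M_h ≠ 0…0`. In `X`, all words greater than `M_h` occur, in the right residue
class, at positions before `R_h`. The windows of `w` at these positions are at least as large as
those of `X`, and one further window of `w`, at the start of `R_h`, is greater than `M_h`; so two of
these windows coincide, which contradicts perfectness (`false_of_window_mem`). If `k ∣ n` and
`M_h = 0…0`, the same counting applies to the words whose first letter is at least the differing
letter of `w`. If `n ∣ k`, all words are maximal and the windows are taken at the start of the copy
of `M_h` that contains the difference.

*The case `k = 1`.* The prefix of length `|R_i|` of `M_i M_i …` is strictly greater than its
nontrivial rotations because `|R_i|` is the least period; conversely a Lyndon word whose length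
divides `n` is the word that comes from its power of length `n`.
-/

set_option linter.unusedSectionVars false

/-! ### Periodic extensions, windows and the lexicographic order -/

/-- The periodic extension `A A A …` of the word `A`. -/
def Word.per {s n : ℕ} [NeZero n] (A : Word s n) (q : ℕ) : Fin s := A (Fin.ofNat n q)

/-- The word formed by the `n` letters of the sequence `f` that start at position `q`. -/
def window {s : ℕ} (n : ℕ) (f : ℕ → Fin s) (q : ℕ) : Word s n := fun i => f (q + i)

section Words

variable {s n k : ℕ}

theorem ofFn_lt_ofFn_iff {A B : Word s n} : List.ofFn A < List.ofFn B ↔ toLex A < toLex B := by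
  rw [List.lt_iff_exists]
  constructor
  · rintro (⟨h1, h2⟩ | ⟨i, h1, h2, h3, h4⟩)
    · simp at h2
    · simp only [List.length_ofFn] at h1
      refine ⟨⟨i, h1⟩, fun j hj => ?_, by simpa using h4⟩
      simpa using h3 j hj
  · rintro ⟨i, h1, h2⟩
    refine Or.inr ⟨i, by simp, by simp, fun j hj => ?_, by simpa using h2⟩
    have := h1 ⟨j, hj.trans i.2⟩ hj
    simpa using this

theorem Word.lt_of_apply_lt {A B : Word s n} (j : ℕ) (hj : j < n)
    (h : ∀ i (hi : i < j), A ⟨i, hi.trans hj⟩ = B ⟨i, hi.trans hj⟩)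
    (h' : A ⟨j, hj⟩ < B ⟨j, hj⟩) : toLex A < toLex B :=
  ⟨⟨j, hj⟩, fun i hi => h i hi, h'⟩

theorem Word.exists_of_lt {A B : Word s n} (h : toLex A < toLex B) :
    ∃ (j : ℕ) (hj : j < n), (∀ i (hi : i < j), A ⟨i, hi.trans hj⟩ = B ⟨i, hi.trans hj⟩) ∧
      A ⟨j, hj⟩ < B ⟨j, hj⟩ := by
  obtain ⟨j, h1, h2⟩ := h
  exact ⟨j, j.2, fun i hi => h1 ⟨i, hi.trans j.2⟩ hi, h2⟩

theorem window_lt_of_apply_lt {f g : ℕ → Fin s} {p q : ℕ} (j : ℕ) (hj : j < n)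
    (h : ∀ i < j, f (p + i) = g (q + i)) (h' : f (p + j) < g (q + j)) :
    toLex (window n f p) < toLex (window n g q) :=
  Word.lt_of_apply_lt j hj h h'

theorem exists_of_window_lt {f g : ℕ → Fin s} {p q : ℕ}
    (h : toLex (window n f p) < toLex (window n g q)) :
    ∃ j < n, (∀ i < j, f (p + i) = g (q + i)) ∧ f (p + j) < g (q + j) := by
  obtain ⟨j, hj, h1, h2⟩ := Word.exists_of_lt h
  exact ⟨j, hj, h1, h2⟩

theorem window_eq_iff {f g : ℕ → Fin s} {p q : ℕ} :
    window n f p = window n g q ↔ ∀ i < n, f (p + i) = g (q + i) :=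
  ⟨fun h i hi => congrFun h ⟨i, hi⟩, fun h => funext fun i => h i i.2⟩

variable [NeZero n]

theorem Word.per_of_lt (A : Word s n) {q : ℕ} (hq : q < n) : A.per q = A ⟨q, hq⟩ := by
  unfold Word.per
  congr 1
  exact Fin.ext (Nat.mod_eq_of_lt hq)

theorem Word.per_mod (A : Word s n) (q : ℕ) : A.per (q % n) = A.per q := by
  unfold Word.per
  congr 1
  exact Fin.ext (Nat.mod_mod q n)

theorem Word.per_add_of_dvd (A : Word s n) (q : ℕ) {d : ℕ} (hd : n ∣ d) :
    A.per (q + d) = A.per q := by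
  obtain ⟨c, rfl⟩ := hd
  rw [← A.per_mod, Nat.add_mul_mod_self_left, A.per_mod]

theorem window_per_zero (A : Word s n) : window n A.per 0 = A := by
  funext i
  simp [window, A.per_of_lt i.2]

theorem Word.per_window (A : Word s n) (d q : ℕ) : (window n A.per d).per q = A.per (d + q) := by
  change A.per (d + q % n) = A.per (d + q)
  rw [← A.per_mod, Nat.add_mod_mod, A.per_mod]

theorem Word.per_injective : Function.Injective (Word.per : Word s n → ℕ → Fin s) := by
  intro A B h
  rw [← window_per_zero A, ← window_per_zero B, h]

theorem window_per_window (A : Word s n) (d e : ℕ) :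
    window n (window n A.per d).per e = window n A.per (d + e) := by
  funext i
  simp [window, Word.per_window, add_assoc]


/-! ### Rotations of pairs and maximal words -/

theorem WordPair.rotate_iterate (P : WordPair s n k) (i : ℕ) :
    WordPair.rotate^[i] P = (window n P.1.per i, P.2 + i) := by
  induction i with
  | zero => simp [window_per_zero]
  | succ i ih =>
    rw [Function.iterate_succ_apply', ih, WordPair.rotate]
    refine Prod.ext ?_ (by push_cast; ring)
    funext j
    change P.1.per (i + (finRotate n j : ℕ)) = P.1.per (i + 1 + j)
    have : (finRotate n j : ℕ) = (j + 1) % n := by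
      obtain ⟨m, rfl⟩ := Nat.exists_eq_succ_of_ne_zero (NeZero.ne n)
      rw [finRotate_apply, Fin.val_add, Fin.val_one', Nat.add_mod_mod]
    rw [this, ← P.1.per_mod, Nat.add_mod_mod, P.1.per_mod]
    congr 1
    ring

/-- A word `M` is maximal if `⟨M, 0⟩` is a maximal pair: `M` is lexicographically at least as large
as each of its rotations by a multiple of `k`. -/
def Word.Maximal (k : ℕ) (M : Word s n) : Prop :=
  ∀ d, k ∣ d → toLex (window n M.per d) ≤ toLex M

variable [NeZero k]

theorem WordPair.succEq_iff {A B : Word s n} {u : ZMod k} :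
    SuccEq (A, u) (B, u) ↔ toLex B ≤ toLex A := by
  simp only [SuccEq, Succ, ofFn_lt_ofFn_iff, lt_irrefl, or_false, and_true, le_iff_lt_or_eq,
    Prod.mk.injEq]
  constructor <;> rintro (h | h)
  · exact Or.inl h
  · exact Or.inr (by rw [h])
  · exact Or.inl h
  · exact Or.inr (toLex.injective h.symm)

theorem WordPair.rotate_iterate_max (hnk : k ∣ n ∨ n ∣ k) (P : WordPair s n k) :
    WordPair.rotate^[max n k] P = P := by
  have h1 : n ∣ max n k := by
    rcases hnk with h | h
    · rw [max_eq_left (Nat.le_of_dvd (NeZero.pos n) h)]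
    · rwa [max_eq_right (Nat.le_of_dvd (NeZero.pos k) h)]
  have h2 : k ∣ max n k := by
    rcases hnk with h | h
    · rwa [max_eq_left (Nat.le_of_dvd (NeZero.pos n) h)]
    · rw [max_eq_right (Nat.le_of_dvd (NeZero.pos k) h)]
  rw [WordPair.rotate_iterate]
  refine Prod.ext ?_ ?_
  · funext i
    change P.1.per (max n k + i) = P.1 i
    rw [add_comm, P.1.per_add_of_dvd _ h1, P.1.per_of_lt i.2]
  · change P.2 + ((max n k : ℕ) : ZMod k) = P.2
    rw [(ZMod.natCast_eq_zero_iff _ _).2 h2, add_zero]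

theorem WordPair.isMaximal_iff (hnk : k ∣ n ∨ n ∣ k) (P : WordPair s n k) :
    P.IsMaximal ↔ P.2 = 0 ∧ P.1.Maximal k := by
  have hpos : 0 < max n k := lt_max_of_lt_left (NeZero.pos n)
  have hmem : ∀ d, WordPair.rotate^[d] P ∈ P.rotations := fun d =>
    ⟨d % max n k, Nat.mod_lt _ hpos, by
      conv_lhs => rw [← Nat.mod_add_div d (max n k), Function.iterate_add_apply,
        Function.iterate_mul]
      rw [Function.iterate_fixed (WordPair.rotate_iterate_max hnk P)]⟩
  constructor
  · intro h
    have h0 : P.2 = 0 := by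
      have h1 := h _ (hmem (k - P.2.val))
      rw [WordPair.rotate_iterate, Nat.cast_sub (ZMod.val_lt P.2).le] at h1
      simp only [CharP.cast_eq_zero, ZMod.natCast_val, ZMod.cast_id', id_eq, zero_sub,
        add_neg_cancel] at h1
      rcases h1 with (h1 | h1) | h1
      · exact h1.2
      · simp at h1
      · exact congrArg Prod.snd h1
    refine ⟨h0, fun d hd => ?_⟩
    have h1 := h _ (hmem d)
    rw [WordPair.rotate_iterate, (ZMod.natCast_eq_zero_iff _ _).2 hd, add_zero] at h1
    exact WordPair.succEq_iff.1 h1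
  · rintro ⟨h0, h⟩ Q ⟨i, -, rfl⟩
    obtain ⟨A, u⟩ := P
    obtain rfl : u = 0 := h0
    rw [WordPair.rotate_iterate]
    by_cases hi : k ∣ i
    · simp only [(ZMod.natCast_eq_zero_iff _ _).2 hi, add_zero]
      exact WordPair.succEq_iff.2 (h i hi)
    · refine Or.inl (Or.inr ?_)
      simp only [ZMod.val_zero, zero_add]
      rw [Nat.pos_iff_ne_zero, ne_eq, ZMod.val_eq_zero, ZMod.natCast_eq_zero_iff]
      exact hi

/-! ### Periods of words -/

/-- The number of different pairs among the rotations of `⟨A, 0⟩`; it is the length of the word of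
the Lyndon pair of `⟨A, 0⟩`. -/
noncomputable def Word.period (k : ℕ) (A : Word s n) : ℕ :=
  Function.minimalPeriod WordPair.rotate ((A, 0) : WordPair s n k)

theorem Word.isPeriodicPt_iff (A : Word s n) (p : ℕ) :
    Function.IsPeriodicPt WordPair.rotate p ((A, 0) : WordPair s n k) ↔
      k ∣ p ∧ Function.Periodic A.per p := by
  rw [Function.IsPeriodicPt, Function.IsFixedPt, WordPair.rotate_iterate, Prod.mk.injEq, zero_add,
    ZMod.natCast_eq_zero_iff, and_comm]
  refine and_congr_right fun _ => ⟨fun h q => ?_, fun h => ?_⟩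
  · rw [add_comm, ← A.per_window, h]
  · refine Word.per_injective (funext fun q => ?_)
    rw [Word.per_window, add_comm, h q]

theorem Word.period_dvd_max (hnk : k ∣ n ∨ n ∣ k) (A : Word s n) : A.period k ∣ max n k :=
  Function.IsPeriodicPt.minimalPeriod_dvd (WordPair.rotate_iterate_max hnk _)

theorem Word.period_pos (hnk : k ∣ n ∨ n ∣ k) (A : Word s n) : 0 < A.period k :=
  Nat.pos_of_dvd_of_pos (A.period_dvd_max hnk) (lt_max_of_lt_left (NeZero.pos n))

theorem Word.dvd_period (A : Word s n) : k ∣ A.period k :=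
  ((A.isPeriodicPt_iff _).1 (Function.isPeriodicPt_minimalPeriod _ _)).1

theorem Word.periodic_period (k : ℕ) [NeZero k] (A : Word s n) :
    Function.Periodic A.per (A.period k) :=
  ((A.isPeriodicPt_iff (k := k) _).1 (Function.isPeriodicPt_minimalPeriod _ _)).2

theorem Word.period_dvd (A : Word s n) {p : ℕ} (h : k ∣ p) (hp : Function.Periodic A.per p) :
    A.period k ∣ p :=
  Function.IsPeriodicPt.minimalPeriod_dvd ((A.isPeriodicPt_iff p).2 ⟨h, hp⟩)

theorem Word.le_period (hnk : k ∣ n ∨ n ∣ k) (A : Word s n) : k ≤ A.period k :=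
  Nat.le_of_dvd (A.period_pos hnk) A.dvd_period

theorem Word.period_of_dvd (hnk : n ∣ k) (A : Word s n) : A.period k = k :=
  have h : A.period k ∣ max n k := A.period_dvd_max (Or.inr hnk)
  Nat.dvd_antisymm (by rwa [max_eq_right (Nat.le_of_dvd (NeZero.pos k) hnk)] at h) A.dvd_period

/-! ### The words of Lyndon pairs -/

theorem wordPow_succ (w : List (Fin s)) (m : ℕ) : wordPow w (m + 1) = w ++ wordPow w m := by
  simp [wordPow, List.replicate_succ]

theorem wordPow_ofFn {f : ℕ → Fin s} {p : ℕ} (hf : f.Periodic p) (m : ℕ) :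
    wordPow (List.ofFn fun r : Fin p => f r) m = List.ofFn fun r : Fin (m * p) => f r := by
  induction m with
  | zero => simp [wordPow]
  | succ m ih =>
    rw [wordPow_succ, ih]
    refine List.ext_getElem (by simp; ring) fun i h1 h2 => ?_
    rw [List.getElem_append]
    split_ifs with h
    · simp
    · simp only [List.length_ofFn, not_lt] at h
      simp only [List.getElem_ofFn, List.length_ofFn]
      rw [← hf (i - p), Nat.sub_add_cancel h]

theorem Word.ofFn_per (A : Word s n) : (List.ofFn fun r : Fin n => A.per r) = List.ofFn A :=
  congrArg List.ofFn (funext fun i => A.per_of_lt i.2)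

theorem Word.take_ofFn (A : Word s n) {p : ℕ} (hp : p ≤ n) :
    (List.ofFn A).take p = List.ofFn fun r : Fin p => A.per r := by
  rw [← A.ofFn_per]
  exact List.ext_getElem (by simpa using hp) fun i h1 h2 => by simp

theorem Word.eq_wordPow_iff (A : Word s n) {p : ℕ} (hp : p ∣ n) :
    List.ofFn A = wordPow ((List.ofFn A).take p) (n / p) ↔ Function.Periodic A.per p := by
  have hp0 : 0 < p := Nat.pos_of_dvd_of_pos hp (NeZero.pos n)
  have : NeZero p := ⟨hp0.ne'⟩
  rw [A.take_ofFn (Nat.le_of_dvd (NeZero.pos n) hp)]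
  constructor
  · intro h
    let B : Word s p := fun r => A.per r
    have hB : Function.Periodic B.per p := fun q => B.per_add_of_dvd q dvd_rfl
    have h1 : (fun r : Fin p => A.per r) = fun r : Fin p => B.per r :=
      funext fun r => (B.per_of_lt r.2).symm
    rw [h1, wordPow_ofFn hB, ← A.ofFn_per, Nat.div_mul_cancel hp] at h
    have h2 := List.ofFn_injective h
    have h3 : A.per = B.per := by
      funext q
      have h4 := congrFun h2 ⟨q % n, Nat.mod_lt _ (NeZero.pos n)⟩
      simp only [A.per_mod] at h4
      rw [h4, ← B.per_mod, Nat.mod_mod_of_dvd _ hp, B.per_mod]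
    rw [h3]
    exact hB
  · intro h
    rw [wordPow_ofFn h, Nat.div_mul_cancel hp, A.ofFn_per]

theorem reductionLength_eq (hkn : k ∣ n) (A : Word s n) : reductionLength k A = A.period k := by
  have hn : A.period k ∣ n := by
    have h := A.period_dvd_max (Or.inl hkn)
    rwa [max_eq_left (Nat.le_of_dvd (NeZero.pos n) hkn)] at h
  refine IsLeast.csInf_eq ⟨⟨A.dvd_period, hn, ?_⟩, fun p ⟨h1, h2, h3⟩ => ?_⟩
  · exact (A.eq_wordPow_iff hn).2 (A.periodic_period k)
  · exact Nat.le_of_dvd (Nat.pos_of_dvd_of_pos h2 (NeZero.pos n))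
      (A.period_dvd h1 ((A.eq_wordPow_iff h2).1 h3))

/-- Reduction and expansion in one formula: the word of the Lyndon pair of `⟨A, u⟩` consists of the
first `A.period k` letters of `A A A …`. -/
theorem lyndonPair_fst (hnk : k ∣ n ∨ n ∣ k) (P : WordPair s n k) :
    (lyndonPair P).1 = List.ofFn fun r : Fin (P.1.period k) => P.1.per r := by
  unfold lyndonPair
  split_ifs with h
  · have hn := P.1.period_dvd_max (Or.inl h)
    rw [max_eq_left (Nat.le_of_dvd (NeZero.pos n) h)] at hn
    rw [reduction, reductionLength_eq h, P.1.take_ofFn (Nat.le_of_dvd (NeZero.pos n) hn)]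
  · have h' := hnk.resolve_left h
    rw [expansion, ← P.1.ofFn_per, wordPow_ofFn fun q => P.1.per_add_of_dvd q dvd_rfl,
      Nat.div_mul_cancel h', P.1.period_of_dvd h']

end Words

/-! ### Consecutive maximal words -/

section Maximal

variable {s n k : ℕ} [NeZero n] [NeZero k] [NeZero s] {M M' : Word s n}

/-- The word `0 … 0`, the least of all words. -/
def zeroWord (s n : ℕ) [NeZero s] : Word s n := fun _ => 0

theorem Word.zeroWord_le (A : Word s n) : toLex (zeroWord s n) ≤ toLex A :=
  Pi.toLex_monotone fun i => Fin.zero_le (A i)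

theorem Word.maximal_zeroWord : Word.Maximal k (zeroWord s n) := fun _ _ => le_rfl

theorem Word.maximal_of_lt (hnk : k ∣ n ∨ n ∣ k)
    (h : ∀ d, 0 < d → d + k ≤ n → k ∣ d → toLex (window n M.per d) ≤ toLex M) : M.Maximal k := by
  intro d hd
  have hw : window n M.per d = window n M.per (d % n) := by
    rw [window_eq_iff]
    intro i _
    rw [← M.per_mod (d % n + i), Nat.mod_add_mod, M.per_mod]
  rw [hw]
  rcases Nat.eq_zero_or_pos (d % n) with h0 | h0
  · rw [h0, window_per_zero]
  · rcases hnk with hkn | hkn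
    · have hd' := (Nat.dvd_mod_iff hkn).2 hd
      refine h _ h0 ?_ hd'
      obtain ⟨a, ha⟩ := hd'
      obtain ⟨b, hb⟩ := hkn
      have h1 : k * a < k * b := by rw [← ha, ← hb]; exact Nat.mod_lt _ (NeZero.pos n)
      have h2 : a + 1 ≤ b := Nat.lt_of_mul_lt_mul_left h1
      calc d % n + k = k * (a + 1) := by rw [ha]; ring
        _ ≤ k * b := Nat.mul_le_mul_left _ h2
        _ = n := hb.symm
    · exact absurd (Nat.mod_eq_zero_of_dvd (hkn.trans hd)) h0.ne'

theorem Word.Maximal.window_le (hM : M.Maximal k) {d : ℕ} (hd : k ∣ d) :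
    toLex (window n M.per d) ≤ toLex (window n M.per 0) :=
  (hM d hd).trans_eq (congrArg toLex (window_per_zero M).symm)

/-- A nonzero maximal word has a nonzero letter among its first `k`: otherwise a rotation by a
multiple of `k` that brings a nonzero letter there is greater. -/
theorem Word.Maximal.exists_ne_zero (hM : M.Maximal k) (h0 : M ≠ zeroWord s n) :
    ∃ i, i < k ∧ i < n ∧ M.per i ≠ 0 := by
  by_contra! h
  refine h0 (funext fun j => ?_)
  by_contra hj
  have hj' : M.per j ≠ 0 := by rwa [M.per_of_lt j.2]
  have hk : (j : ℕ) % k < k := Nat.mod_lt _ (NeZero.pos k)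
  have hn : (j : ℕ) % k < n := (Nat.mod_le _ _).trans_lt j.2
  have hmod : k * (j / k) + (j : ℕ) % k = j := Nat.div_add_mod _ _
  have h1 := hM.window_le (dvd_mul_right k (j / k))
  rcases h1.eq_or_lt with h1 | h1
  · have h2 := window_eq_iff.1 (toLex.injective h1) _ hn
    rw [hmod, zero_add, h _ hk hn] at h2
    exact hj' h2
  · obtain ⟨e, he, h2, h3⟩ := exists_of_window_lt h1
    rw [zero_add] at h3
    have hke : k ≤ e := by
      by_contra! hek
      rw [h e hek he] at h3
      exact (Fin.zero_le _).not_gt h3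
    have h4 := h2 _ (hk.trans_le hke)
    rw [hmod, zero_add, h _ hk hn] at h4
    exact hj' h4

/-- Replacing the last nonzero letter of a maximal word by `0` gives a maximal word. This bounds
the next smaller maximal word from below. -/
theorem Word.Maximal.update_zero (hnk : k ∣ n ∨ n ∣ k) (hM : M.Maximal k) {j : Fin n}
    (hj : M j ≠ 0) (hz : ∀ i, j < i → M i = 0) :
    Word.Maximal k (Function.update M j 0 : Word s n) := by
  obtain ⟨N, hN⟩ : ∃ N : Word s n, N = Function.update M j 0 := ⟨_, rfl⟩
  rw [← hN]
  have hNj : N.per j = 0 := by rw [N.per_of_lt j.2, hN]; simp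
  have hNe : ∀ i < n, i ≠ j → N.per i = M.per i := fun i hi hij => by
    rw [N.per_of_lt hi, M.per_of_lt hi, hN, Function.update_of_ne]
    exact fun h => hij (congrArg Fin.val h)
  have hNz : ∀ i < n, (j : ℕ) ≤ i → N.per i = 0 := fun i hi hij => by
    rcases hij.eq_or_lt with rfl | hij
    · exact hNj
    · rw [hNe i hi hij.ne', M.per_of_lt hi]
      exact hz _ hij
  have hj' : M.per j ≠ 0 := by rwa [M.per_of_lt j.2]
  refine Word.maximal_of_lt hnk fun d hd0 hdn hd => ?_
  refine le_of_le_of_eq ?_ (congrArg toLex (window_per_zero N))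
  rcases le_or_gt d j with hdj | hdj
  · -- the window at `d` has its zero in a place where `N` has kept the letter of `M`
    refine le_of_lt ?_
    have hjn := j.2
    have h1 := hM.window_le hd
    have hlast : M.per (0 + (j - d)) = N.per (0 + (j - d)) := (hNe _ (by omega) (by omega)).symm
    have hdj' : d + (j - d) = (j : ℕ) := by omega
    have key : ∀ e < n, e ≤ j - d → (∀ i < e, M.per (d + i) = M.per (0 + i)) →
        N.per (d + e) < N.per (0 + e) → toLex (window n N.per d) < toLex (window n N.per 0) := by
      intro e he hej h2 h3
      refine window_lt_of_apply_lt e he (fun i hi => ?_) h3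
      rw [hNe _ (by omega) (by omega), hNe _ (by omega) (by omega), h2 i hi]
    by_cases hall : ∀ i < j - d, M.per (d + i) = M.per (0 + i)
    · refine key (j - d) (by omega) le_rfl hall ?_
      have h4 : M.per j ≤ M.per (0 + (j - d)) := by
        by_contra! h5
        refine absurd h1 (not_le.2 (window_lt_of_apply_lt (j - d) (by omega)
          (fun i hi => (hall i hi).symm) ?_))
        rwa [hdj']
      rw [hdj', hNj, ← hlast]
      exact (Fin.pos_iff_ne_zero.2 hj').trans_le h4
    · push Not at hall
      rcases h1.eq_or_lt with h1 | h1
      · obtain ⟨i, hi, h2⟩ := hall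
        exact absurd (window_eq_iff.1 (toLex.injective h1) i (by omega)) h2
      · obtain ⟨e, he, h2, h3⟩ := exists_of_window_lt h1
        obtain ⟨i, hi, h4⟩ := hall
        have hei : e ≤ i := by
          by_contra! h5
          exact h4 (h2 i h5)
        refine key e he (by omega) h2 ?_
        rwa [hNe _ (by omega) (by omega), hNe _ (by omega) (by omega)]
  · -- the window at `d` begins with at least `k` zeros
    by_cases hall : ∀ i < n - d, N.per i = 0
    · have hM0 : M ≠ zeroWord s n := fun h => hj (by rw [h]; rfl)
      obtain ⟨i, hik, hin, hi⟩ := hM.exists_ne_zero hM0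
      have hij : i = j := by
        by_contra hij
        exact hi (by rw [← hNe i hin hij, hall i (by omega)])
      have hN0 : N = zeroWord s n := by
        funext i'
        rw [← N.per_of_lt i'.2]
        rcases lt_or_ge (i' : ℕ) (n - d) with h | h
        · exact hall _ h
        · exact hNz _ i'.2 (by omega)
      rw [hN0]
      exact le_rfl
    · push Not at hall
      have hex : ∃ i, N.per i ≠ 0 := hall.imp fun i hi => hi.2
      obtain ⟨i, hi, hne⟩ := hall
      have hle : Nat.find hex ≤ i := Nat.find_min' hex hne
      refine (window_lt_of_apply_lt (Nat.find hex) (by omega) (fun i' hi' => ?_) ?_).le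
      · have h1 := Nat.find_min hex hi'
        rw [hNz _ (by omega) (by omega), zero_add]
        exact (not_not.1 h1).symm
      · rw [hNz _ (by omega) (by omega), zero_add]
        exact Fin.pos_iff_ne_zero.2 (Nat.find_spec hex)

/-- `j` is the position of the last nonzero letter of `M`. -/
def Word.IsLastNonzero (M : Word s n) (j : ℕ) : Prop :=
  j < n ∧ M.per j ≠ 0 ∧ ∀ i, j < i → i < n → M.per i = 0

theorem Word.exists_isLastNonzero (h0 : M ≠ zeroWord s n) : ∃ j, M.IsLastNonzero j := by
  obtain ⟨i, hi⟩ := Function.ne_iff.1 h0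
  obtain ⟨j, h1, h2⟩ := (Finset.univ.filter fun i : Fin n => M i ≠ 0).exists_maximal
    ⟨i, by simpa [zeroWord] using hi⟩
  simp only [Finset.mem_filter, Finset.mem_univ, true_and] at h1 h2
  refine ⟨j, j.2, by rwa [M.per_of_lt j.2], fun i hij hi => ?_⟩
  rw [M.per_of_lt hi]
  by_contra h
  exact absurd (h2 h (le_of_lt (show j < ⟨i, hi⟩ from hij))) (not_le.2 hij)

/-- If no maximal word lies strictly between `M' < M`, then `M'` agrees with `M` before the last
nonzero letter of `M`. -/
theorem Word.Maximal.agree_of_consecutive (hnk : k ∣ n ∨ n ∣ k) (hM : M.Maximal k)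
    (hlt : toLex M' < toLex M)
    (hcons : ∀ N : Word s n, N.Maximal k → toLex N < toLex M → toLex N ≤ toLex M') {j : ℕ}
    (hj : M.IsLastNonzero j) : ∀ i < j, M'.per i = M.per i := by
  obtain ⟨hjn, hj0, hz⟩ := hj
  rw [M.per_of_lt hjn] at hj0
  have hN := hM.update_zero hnk (j := ⟨j, hjn⟩) hj0 fun i hi => by
    rw [← M.per_of_lt i.2]; exact hz i hi i.2
  have hN' := hcons _ hN (Pi.toLex_update_lt_self_iff.2 (Fin.pos_iff_ne_zero.2 hj0))
  obtain ⟨e, he, h1, h2⟩ := Word.exists_of_lt hlt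
  have hje : j ≤ e := by
    by_contra! hej
    refine absurd hN' (not_le.2 (Word.lt_of_apply_lt e he (fun i hi => ?_) ?_))
    · rw [h1 i hi, Function.update_of_ne]
      simp only [ne_eq, Fin.mk.injEq]; omega
    · rwa [Function.update_of_ne]
      simp only [ne_eq, Fin.mk.injEq]; omega
  intro i hi
  rw [M.per_of_lt (hi.trans hjn), M'.per_of_lt (hi.trans hjn)]
  exact h1 i (hi.trans_le hje)

/-- The last maximal word before `0 … 0` has a single nonzero letter, which is among the first
`k`. -/
theorem Word.Maximal.lt_of_consecutive_zeroWord (hnk : k ∣ n ∨ n ∣ k) (hM : M.Maximal k)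
    (hlt : toLex (zeroWord s n) < toLex M)
    (hcons : ∀ N : Word s n, N.Maximal k → toLex N < toLex M → toLex N ≤ toLex (zeroWord s n))
    {j : ℕ} (hj : M.IsLastNonzero j) : j < k := by
  obtain ⟨i, hik, hin, hi⟩ := hM.exists_ne_zero fun h => by rw [h] at hlt; exact lt_irrefl _ hlt
  rcases lt_trichotomy i j with h | h | h
  · exact absurd (hM.agree_of_consecutive hnk hlt hcons hj i h).symm hi
  · exact h ▸ hik
  · exact absurd (hj.2.2 i h hin) hi

theorem Word.IsLastNonzero.le_period_add (hnk : k ∣ n ∨ n ∣ k) {j : ℕ} (hj : M.IsLastNonzero j) :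
    n ≤ M.period k + j := by
  by_contra! h
  have h1 := hj.2.2 (M.period k + j) (by have := M.period_pos (k := k) hnk; omega) h
  rw [add_comm, M.periodic_period k j] at h1
  exact hj.2.1 h1

/-- `0 … 0 a 0 … 0`, with `min k n - 1` zeros before the letter `a`, is maximal. -/
theorem Word.maximal_single (hnk : k ∣ n ∨ n ∣ k) {a : Fin s} (ha : a ≠ 0) (j : Fin n)
    (hj : (j : ℕ) + 1 = min k n) :
    Word.Maximal k (Function.update (zeroWord s n) j a : Word s n) := by
  obtain ⟨N, hN⟩ : ∃ N : Word s n, N = Function.update (zeroWord s n) j a := ⟨_, rfl⟩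
  rw [← hN]
  have hNj : N.per j = a := by rw [N.per_of_lt j.2, hN]; simp
  have hNz : ∀ i < n, i ≠ j → N.per i = 0 := fun i hi hij => by
    rw [N.per_of_lt hi, hN, Function.update_of_ne]
    · rfl
    · exact fun h => hij (congrArg Fin.val h)
  refine Word.maximal_of_lt hnk fun d hd0 hdn hd => ?_
  have hkd : k ≤ d := Nat.le_of_dvd hd0 hd
  refine le_of_le_of_eq ?_ (congrArg toLex (window_per_zero N))
  refine (window_lt_of_apply_lt j j.2 (fun i hi => ?_) ?_).le
  · rw [hNz _ (by omega) (by omega), hNz _ (by omega) (by omega)]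
  · rw [hNz _ (by omega) (by omega), zero_add, hNj]
    exact Fin.pos_iff_ne_zero.2 ha

end Maximal

/-! ### Every pair is a rotation of a maximal pair -/

section Orbits

variable {s n k : ℕ} [NeZero n] [NeZero k]

theorem exists_maximal_rotation (hnk : k ∣ n ∨ n ∣ k) (W : Word s n) {ρ : ℕ} (hρ : ρ < k) :
    ∃ M : Word s n, M.Maximal k ∧ ∃ r < M.period k, r % k = ρ ∧ window n M.per r = W := by
  have hn : 1 ≤ n := NeZero.pos n
  obtain ⟨W₀, hW₀⟩ : ∃ W₀ : Word s n, window n W₀.per ρ = W := by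
    refine ⟨window n W.per (n * k - ρ), ?_⟩
    rw [window_per_window, Nat.sub_add_cancel (hρ.le.trans (Nat.le_mul_of_pos_left k hn))]
    funext i
    change W.per (n * k + i) = W i
    rw [add_comm, W.per_add_of_dvd _ (dvd_mul_right _ _), W.per_of_lt i.2]
  obtain ⟨M, ⟨d, rfl⟩, hmax⟩ := (Set.toFinite
    (Set.range fun d => toLex (window n W₀.per (k * d)))).exists_maximal ⟨_, 0, rfl⟩
  simp only [Set.mem_range, forall_exists_index, forall_apply_eq_imp_iff] at hmax
  have hM : (window n W₀.per (k * d)).Maximal k := by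
    rintro _ ⟨d', rfl⟩
    rw [window_per_window, ← mul_add]
    exact (le_total _ _).elim id fun h => hmax _ h
  refine ⟨_, hM, (k * (d * (n - 1)) + ρ) % Word.period k (window n W₀.per (k * d)),
    Nat.mod_lt _ (Word.period_pos hnk _), ?_, ?_⟩
  · rw [Nat.mod_mod_of_dvd _ (Word.dvd_period _), Nat.mul_add_mod, Nat.mod_eq_of_lt hρ]
  · rw [← hW₀]
    funext i
    change Word.per _ (_ % _ + i) = W₀.per (ρ + i)
    rw [← (Word.periodic_period k _).map_mod_nat (_ + _), Nat.mod_add_mod,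
      (Word.periodic_period k _).map_mod_nat, Word.per_window,
      ← W₀.per_add_of_dvd (ρ + i) (dvd_mul_right n (k * d))]
    congr 1
    obtain ⟨m, rfl⟩ := Nat.exists_eq_add_of_le hn
    rw [Nat.add_sub_cancel_left]
    ring

theorem Word.Maximal.eq_of_window_eq {M M' : Word s n} (hM : M.Maximal k) (hM' : M'.Maximal k)
    {r r' : ℕ} (hr : r % k = r' % k) (h : window n M.per r = window n M'.per r') : M = M' := by
  have key : ∀ {A B : Word s n} {a b : ℕ}, A.Maximal k → a % k = b % k →
      window n A.per a = window n B.per b → toLex B ≤ toLex A := by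
    intro A B a b hA hab h
    have h0 : b + b * (n * k - 1) = b * n * k := by
      obtain ⟨m, hm⟩ := Nat.exists_eq_succ_of_ne_zero
        (Nat.mul_pos (NeZero.pos n) (NeZero.pos k)).ne'
      rw [mul_assoc, hm, Nat.succ_sub_one, Nat.succ_eq_add_one]
      ring
    have h1 : window n A.per (a + b * (n * k - 1)) = B := by
      rw [← window_per_window, h, window_per_window, h0]
      funext i
      change B.per (b * n * k + i) = B i
      rw [add_comm, B.per_add_of_dvd _ ⟨b * k, by ring⟩, B.per_of_lt i.2]
    rw [← h1]
    refine hA _ ?_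
    have h2 : a + b * (n * k - 1) ≡ b + b * (n * k - 1) [MOD k] := Nat.ModEq.add_right _ hab
    rw [h0] at h2
    exact (Nat.modEq_zero_iff_dvd.1 (h2.trans (Nat.modEq_zero_iff_dvd.2 (dvd_mul_left _ _))))
  exact toLex.injective ((key hM' hr.symm h.symm).antisymm (key hM hr h))

theorem Word.window_injOn (M : Word s n) {r r' : ℕ} (hr : r < M.period k)
    (hr' : r' < M.period k) (hrr : r % k = r' % k)
    (h : window n M.per r = window n M.per r') : r = r' := by
  refine Function.iterate_injOn_Iio_minimalPeriod (f := WordPair.rotate)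
    (x := ((M, 0) : WordPair s n k)) hr hr' ?_
  simp only [WordPair.rotate_iterate]
  rw [h, (ZMod.natCast_eq_natCast_iff' r r' k).2 hrr]

end Orbits

/-! ### The list of maximal words and its concatenation -/

theorem List.getElem?_flatten_sum_take_add {α : Type*} (L : List (List α)) {i r : ℕ}
    (hi : i < L.length) (hr : r < L[i].length) :
    L.flatten[((L.take i).map List.length).sum + r]? = some L[i][r] := by
  induction L generalizing i with
  | nil => simp at hi
  | cons w L ih =>
    cases i with
    | zero =>
      simp only [List.getElem_cons_zero] at hr
      simp [List.getElem?_append_left hr, List.getElem?_eq_getElem hr]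
    | succ i =>
      simp only [List.getElem_cons_succ] at hr
      simp only [List.flatten_cons, List.take_succ_cons, List.map_cons, List.sum_cons,
        List.getElem_cons_succ]
      rw [List.getElem?_append_right (by omega), add_assoc, Nat.add_sub_cancel_left]
      exact ih _ hr

/-- The word `w` read circularly, as a sequence (constantly `0` for the empty word). -/
def circ {s : ℕ} [NeZero s] (w : List (Fin s)) (q : ℕ) : Fin s := w.getD (q % w.length) 0

theorem circ_of_getElem? {s : ℕ} [NeZero s] {w : List (Fin s)} {q : ℕ} {a : Fin s}
    (h : w[q]? = some a) : circ w q = a := by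
  obtain ⟨hq, h⟩ := List.getElem?_eq_some_iff.1 h
  simp [circ, Nat.mod_eq_of_lt hq, hq, h]

theorem circ_mod {s : ℕ} [NeZero s] (w : List (Fin s)) (q : ℕ) :
    circ w (q % w.length) = circ w q := by
  simp [circ]

theorem circ_add_length {s : ℕ} [NeZero s] (w : List (Fin s)) (q : ℕ) :
    circ w (q + w.length) = circ w q := by
  simp [circ]

section Concat

variable (s n k : ℕ) [NeZero k]

/-- The number of maximal words. -/
noncomputable abbrev numMax : ℕ := (maximalPairs s n k).length

/-- The position at which the word of the `i`-th Lyndon pair starts in the concatenation. -/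
noncomputable def start (i : ℕ) : ℕ := (((lyndonPairWords s n k).take i).map List.length).sum

variable [NeZero s]

/-- The maximal words in decreasing order, numbered from `0` (and `0 … 0` past the end). -/
noncomputable def maxWord (i : ℕ) : Word s n :=
  ((maximalPairs s n k).map Prod.fst).getD i (zeroWord s n)

variable {s n k} [NeZero n]

theorem mem_maximalPairs (hnk : k ∣ n ∨ n ∣ k) {P : WordPair s n k} :
    P ∈ maximalPairs s n k ↔ P.2 = 0 ∧ P.1.Maximal k := by
  classical
  rw [maximalPairs, Finset.mem_sort, Finset.mem_filter, WordPair.isMaximal_iff hnk]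
  simp

theorem pairwise_maximalPairs : (maximalPairs s n k).Pairwise WordPair.Succ := by
  have h1 : (maximalPairs s n k).Pairwise WordPair.SuccEq := by
    unfold maximalPairs; exact Finset.pairwise_sort _ _
  have h2 : (maximalPairs s n k).Nodup := by
    unfold maximalPairs; exact Finset.sort_nodup _ _
  exact (h1.and h2).imp fun h => h.1.resolve_right h.2

theorem maxWord_eq {i : ℕ} (hi : i < numMax s n k) :
    maxWord s n k i = ((maximalPairs s n k)[i]'hi).1 := by
  rw [maxWord, List.getD_eq_getElem _ _ (by simpa using hi), List.getElem_map]

theorem maximalPairs_getElem (hnk : k ∣ n ∨ n ∣ k) {i : ℕ} (hi : i < numMax s n k) :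
    (maximalPairs s n k)[i]'hi = (maxWord s n k i, 0) := by
  have h := (mem_maximalPairs hnk).1 (List.getElem_mem hi)
  exact Prod.ext (maxWord_eq hi).symm h.1

theorem maximal_maxWord (hnk : k ∣ n ∨ n ∣ k) {i : ℕ} (hi : i < numMax s n k) :
    (maxWord s n k i).Maximal k := by
  rw [maxWord_eq hi]
  exact ((mem_maximalPairs hnk).1 (List.getElem_mem hi)).2

theorem exists_maxWord_eq (hnk : k ∣ n ∨ n ∣ k) {M : Word s n} (hM : M.Maximal k) :
    ∃ i < numMax s n k, maxWord s n k i = M := by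
  have h : ((M, 0) : WordPair s n k) ∈ maximalPairs s n k := (mem_maximalPairs hnk).2 ⟨rfl, hM⟩
  obtain ⟨i, hi, h⟩ := List.getElem_of_mem h
  exact ⟨i, hi, by rw [maxWord_eq hi, h]⟩

theorem maxWord_lt (hnk : k ∣ n ∨ n ∣ k) {i j : ℕ} (hij : i < j) (hj : j < numMax s n k) :
    toLex (maxWord s n k j) < toLex (maxWord s n k i) := by
  have h := List.pairwise_iff_getElem.1 (pairwise_maximalPairs (s := s) (n := n) (k := k)) i j
    (hij.trans hj) hj hij
  rw [maximalPairs_getElem hnk hj, maximalPairs_getElem hnk (hij.trans hj)] at h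
  rcases h with ⟨h, -⟩ | h
  · exact ofFn_lt_ofFn_iff.1 h
  · simp at h

theorem lt_of_maxWord_lt (hnk : k ∣ n ∨ n ∣ k) {i j : ℕ} (hi : i < numMax s n k)
    (h : toLex (maxWord s n k j) < toLex (maxWord s n k i)) : i < j := by
  by_contra! hji
  rcases hji.eq_or_lt with rfl | hji
  · exact lt_irrefl _ h
  · exact lt_asymm h (maxWord_lt hnk hji hi)

theorem maxWord_ne_zeroWord (hnk : k ∣ n ∨ n ∣ k) {i : ℕ} (hi : i + 1 < numMax s n k) :
    maxWord s n k i ≠ zeroWord s n := by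
  intro h
  have h1 := maxWord_lt hnk (Nat.lt_succ_self i) hi
  rw [h] at h1
  exact absurd h1 (not_lt.2 (Word.zeroWord_le _))

theorem numMax_pos (hnk : k ∣ n ∨ n ∣ k) : 0 < numMax s n k := by
  obtain ⟨i, hi, -⟩ := exists_maxWord_eq hnk (Word.maximal_zeroWord (s := s) (n := n) (k := k))
  exact (Nat.zero_le i).trans_lt hi

theorem maxWord_last (hnk : k ∣ n ∨ n ∣ k) :
    maxWord s n k (numMax s n k - 1) = zeroWord s n := by
  obtain ⟨i, hi, h⟩ := exists_maxWord_eq hnk (Word.maximal_zeroWord (s := s) (n := n) (k := k))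
  have : ¬ i + 1 < numMax s n k := fun h' => maxWord_ne_zeroWord hnk h' h
  rw [← h]
  congr 1
  omega

theorem succ_lt_numMax (hnk : k ∣ n ∨ n ∣ k) {i : ℕ} (hi : i < numMax s n k)
    (h : maxWord s n k i ≠ zeroWord s n) : i + 1 < numMax s n k := by
  by_contra h'
  refine h ?_
  rw [← maxWord_last hnk]
  congr 1
  omega

theorem le_maxWord_succ (hnk : k ∣ n ∨ n ∣ k) {i : ℕ} {N : Word s n}
    (hN : N.Maximal k) (hlt : toLex N < toLex (maxWord s n k i)) (hi : i < numMax s n k) :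
    toLex N ≤ toLex (maxWord s n k (i + 1)) := by
  obtain ⟨j, hj, rfl⟩ := exists_maxWord_eq hnk hN
  have h := lt_of_maxWord_lt hnk hi hlt
  rcases (Nat.succ_le_of_lt h).eq_or_lt with h | h
  · rw [← h]
  · exact (maxWord_lt hnk h hj).le

theorem length_lyndonPairWords (s n k : ℕ) [NeZero k] :
    (lyndonPairWords s n k).length = numMax s n k := by
  simp [lyndonPairWords, lyndonPairs, numMax]

theorem lyndonPairWords_getElem (hnk : k ∣ n ∨ n ∣ k) {i : ℕ} (hi : i < numMax s n k) :
    (lyndonPairWords s n k)[i]'((length_lyndonPairWords s n k).symm ▸ hi) =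
      List.ofFn fun r : Fin ((maxWord s n k i).period k) => (maxWord s n k i).per r := by
  simp only [lyndonPairWords, lyndonPairs, List.getElem_map, lyndonPair_fst hnk]
  rw [maximalPairs_getElem hnk hi]

theorem start_zero : start s n k 0 = 0 := by simp [start]

theorem start_succ (hnk : k ∣ n ∨ n ∣ k) {i : ℕ} (hi : i < numMax s n k) :
    start s n k (i + 1) = start s n k i + (maxWord s n k i).period k := by
  have hi' : i < (lyndonPairWords s n k).length := (length_lyndonPairWords s n k).symm ▸ hi
  rw [start, List.take_succ_eq_append_getElem hi', List.map_append, List.sum_append,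
    lyndonPairWords_getElem hnk hi]
  simp [start]

theorem start_numMax : start s n k (numMax s n k) = (lyndonConcat s n k).length := by
  rw [start, ← length_lyndonPairWords s n k, List.take_length, lyndonConcat, List.length_flatten]

theorem dvd_start (hnk : k ∣ n ∨ n ∣ k) {i : ℕ} (hi : i ≤ numMax s n k) : k ∣ start s n k i := by
  induction i with
  | zero => rw [start_zero]; exact dvd_zero k
  | succ i ih =>
    rw [start_succ hnk hi]
    exact dvd_add (ih (Nat.le_of_succ_le hi)) (Word.dvd_period _)

theorem start_eq_sum (hnk : k ∣ n ∨ n ∣ k) {i : ℕ} (hi : i ≤ numMax s n k) :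
    start s n k i = ∑ j ∈ Finset.range i, (maxWord s n k j).period k := by
  induction i with
  | zero => rw [start_zero]; simp
  | succ i ih =>
    rw [start_succ hnk hi, ih (Nat.le_of_succ_le hi), Finset.sum_range_succ]

theorem start_mono (hnk : k ∣ n ∨ n ∣ k) {i j : ℕ} (hij : i ≤ j) (hj : j ≤ numMax s n k) :
    start s n k i ≤ start s n k j := by
  rw [start_eq_sum hnk hj, start_eq_sum hnk (hij.trans hj)]
  exact Finset.sum_le_sum_of_subset (Finset.range_mono hij)

theorem circ_start_add (hnk : k ∣ n ∨ n ∣ k) {i r : ℕ} (hi : i < numMax s n k)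
    (hr : r < (maxWord s n k i).period k) :
    circ (lyndonConcat s n k) (start s n k i + r) = (maxWord s n k i).per r := by
  have hi' : i < (lyndonPairWords s n k).length := (length_lyndonPairWords s n k).symm ▸ hi
  have h := lyndonPairWords_getElem hnk hi
  refine circ_of_getElem? ?_
  rw [lyndonConcat, start, List.getElem?_flatten_sum_take_add _ hi' (by rw [h]; simpa using hr)]
  simp [h]

/-- Every position of the concatenation lies in the word of one of the Lyndon pairs. -/
theorem exists_eq_start_add (hnk : k ∣ n ∨ n ∣ k) {q : ℕ} (hq : q < (lyndonConcat s n k).length) :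
    ∃ i < numMax s n k, ∃ r < (maxWord s n k i).period k, q = start s n k i + r := by
  rw [← start_numMax] at hq
  have hex : ∃ i, q < start s n k i := ⟨_, hq⟩
  have h1 := Nat.find_spec hex
  have h2 : Nat.find hex ≤ numMax s n k := Nat.find_min' hex hq
  have h3 : Nat.find hex ≠ 0 := fun h => by rw [h, start_zero] at h1; omega
  obtain ⟨i, hi⟩ := Nat.exists_eq_succ_of_ne_zero h3
  have h4 : start s n k i ≤ q := not_lt.1 (Nat.find_min hex (by omega))
  rw [hi, Nat.succ_eq_add_one, start_succ hnk (by omega)] at h1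
  exact ⟨i, by omega, q - start s n k i, by omega, by omega⟩

/-- The pairs `⟨maximal word, number of rotations⟩` correspond to the pairs in `Σ^n × ℤ_k`. -/
theorem length_lyndonConcat (hnk : k ∣ n ∨ n ∣ k) : (lyndonConcat s n k).length = s ^ n * k := by
  rw [← start_numMax, start_eq_sum hnk le_rfl]
  have h1 : ∑ j ∈ Finset.range (numMax s n k), (maxWord s n k j).period k =
      ((Finset.range (numMax s n k)).sigma
        fun j => Finset.range ((maxWord s n k j).period k)).card := by simp
  have h2 : s ^ n * k = ((Finset.univ : Finset (Word s n)) ×ˢ Finset.range k).card := by simp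
  rw [h1, h2]
  refine Finset.card_bij (fun x _ => (window n (maxWord s n k x.1).per x.2, x.2 % k)) ?_ ?_ ?_
  · intro x _
    simpa using Nat.mod_lt _ (NeZero.pos k)
  · rintro ⟨i, r⟩ hx ⟨i', r'⟩ hx' h
    simp only [Finset.mem_sigma, Finset.mem_range] at hx hx'
    simp only [Prod.mk.injEq] at h
    have h3 := (maximal_maxWord hnk hx.1).eq_of_window_eq (maximal_maxWord hnk hx'.1) h.2 h.1
    obtain rfl : i = i' := by
      by_contra hne
      rcases lt_or_gt_of_ne hne with hlt | hlt
      · exact absurd (maxWord_lt hnk hlt hx'.1) (by rw [h3]; exact lt_irrefl _)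
      · exact absurd (maxWord_lt hnk hlt hx.1) (by rw [h3]; exact lt_irrefl _)
    rw [Word.window_injOn _ hx.2 hx'.2 h.2 h.1]
  · rintro ⟨W, ρ⟩ h
    simp only [Finset.mem_product, Finset.mem_univ, true_and, Finset.mem_range] at h
    obtain ⟨M, hM, r, hr, h3, h4⟩ := exists_maximal_rotation hnk W h
    obtain ⟨i, hi, rfl⟩ := exists_maxWord_eq hnk hM
    exact ⟨⟨i, r⟩, by simp [hi, hr], by rw [h3, h4]⟩

end Concat

/-! ### The concatenation follows the maximal words -/

section Agreement

variable {s n k : ℕ} [NeZero n] [NeZero k] [NeZero s]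

/-- Counted from the right end of a period, the letters after the last nonzero one vanish. -/
theorem Word.IsLastNonzero.per_period_sub (hnk : k ∣ n ∨ n ∣ k) {M : Word s n} {j y : ℕ}
    (hj : M.IsLastNonzero j) (hy : 0 < y) (hyj : y + j < n) : M.per (M.period k - y) = 0 := by
  have h1 := hj.le_period_add (k := k) hnk
  have hd : n ∣ max n k := by
    rcases hnk with h | h
    · rw [max_eq_left (Nat.le_of_dvd (NeZero.pos n) h)]
    · rwa [max_eq_right (Nat.le_of_dvd (NeZero.pos k) h)]
  have hpos : 0 < max n k := lt_max_of_lt_left (NeZero.pos n)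
  have hle : M.period k ≤ max n k := Nat.le_of_dvd hpos (M.period_dvd_max hnk)
  have hle' : n ≤ max n k := le_max_left _ _
  obtain ⟨c, hc⟩ := Nat.dvd_sub (M.period_dvd_max hnk) (dvd_refl (M.period k))
  have h2 := (M.periodic_period k).nat_mul c (M.period k - y)
  have h3 : M.period k - y + c * M.period k = n - y + (max n k - n) := by
    rw [mul_comm c, ← hc]; omega
  rw [Nat.cast_id, h3, M.per_add_of_dvd _ (Nat.dvd_sub hd dvd_rfl)] at h2
  rw [← h2]
  exact hj.2.2 _ (by omega) (by omega)

/-- The concatenation of the words of the Lyndon pairs, read circularly. -/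
noncomputable abbrev lyndonSeq (s n k : ℕ) [NeZero k] [NeZero s] : ℕ → Fin s :=
  circ (lyndonConcat s n k)

/-- Let `j` be the position of the last nonzero letter of the maximal word `M`. From the start of
the word of the Lyndon pair of `M` on, the concatenation agrees with `M M M …` throughout this word
and for `j` more letters, because the next maximal word agrees with `M` before position `j`. -/
theorem lyndonSeq_start_add (hnk : k ∣ n ∨ n ∣ k) {i : ℕ} (hi : i + 1 < numMax s n k) {j : ℕ}
    (hj : (maxWord s n k i).IsLastNonzero j) {q : ℕ} (hq : q < (maxWord s n k i).period k + j) :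
    lyndonSeq s n k (start s n k i + q) = (maxWord s n k i).per q := by
  induction hd : numMax s n k - i generalizing i j q with
  | zero => omega
  | succ d ih =>
    rcases lt_or_ge q ((maxWord s n k i).period k) with hlt | hge
    · exact circ_start_add hnk (by omega) hlt
    · obtain ⟨q, rfl⟩ := Nat.exists_eq_add_of_le hge
      have hqj : q < j := by omega
      have hM := maximal_maxWord hnk (show i < numMax s n k by omega)
      have hlt := maxWord_lt hnk (Nat.lt_succ_self i) hi
      have hcons : ∀ N : Word s n, N.Maximal k → toLex N < toLex (maxWord s n k i) →
          toLex N ≤ toLex (maxWord s n k (i + 1)) := fun N hN h =>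
        le_maxWord_succ hnk hN h (by omega)
      rw [← add_assoc, ← start_succ hnk (by omega),
        add_comm ((maxWord s n k i).period k) q, (maxWord s n k i).periodic_period k q,
        ← hM.agree_of_consecutive hnk hlt hcons hj q hqj]
      by_cases hz : maxWord s n k (i + 1) = zeroWord s n
      · rw [Nat.succ_eq_add_one, hz] at hlt
        rw [hz] at hcons
        have hjk := hM.lt_of_consecutive_zeroWord hnk hlt hcons hj
        exact circ_start_add hnk hi ((hqj.trans hjk).trans_le (Word.le_period hnk _))
      · obtain ⟨j', hj'⟩ := Word.exists_isLastNonzero hz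
        have h1 := hj'.le_period_add (k := k) hnk
        have h2 := hj.1
        exact ih (succ_lt_numMax hnk hi hz) hj' (by omega) (by omega)

theorem lyndonSeq_start_add_of_lt (hnk : k ∣ n ∨ n ∣ k) {i : ℕ} (hi : i + 1 < numMax s n k) {q : ℕ}
    (hq : q < n) : lyndonSeq s n k (start s n k i + q) = (maxWord s n k i).per q := by
  obtain ⟨j, hj⟩ := Word.exists_isLastNonzero (maxWord_ne_zeroWord hnk hi)
  exact lyndonSeq_start_add hnk hi hj (hq.trans_le (hj.le_period_add hnk))

theorem period_zeroWord (hnk : k ∣ n ∨ n ∣ k) : (zeroWord s n).period k = k :=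
  le_antisymm (Nat.le_of_dvd (NeZero.pos k) (Word.period_dvd _ dvd_rfl fun _ => rfl))
    (Word.le_period hnk _)

/-- The concatenation ends with `n` zeros. -/
theorem lyndonSeq_end (hnk : k ∣ n ∨ n ∣ k) {q y : ℕ} (hy : 0 < y) (hyn : y ≤ n)
    (hq : q + y = (lyndonConcat s n k).length) : lyndonSeq s n k q = 0 := by
  have hpos := numMax_pos (s := s) hnk
  rw [← start_numMax] at hq
  have hlast := maxWord_last (s := s) hnk
  obtain ⟨m, hm⟩ := Nat.exists_eq_succ_of_ne_zero hpos.ne'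
  rw [Nat.succ_eq_add_one] at hm
  rw [hm, Nat.add_sub_cancel] at hlast
  rw [hm, start_succ hnk (by omega), hlast, period_zeroWord hnk] at hq
  rcases le_or_gt y k with hyk | hyk
  · have h1 := circ_start_add (s := s) hnk (i := m) (r := k - y) (by omega)
      (by rw [hlast, period_zeroWord hnk]; omega)
    rw [hlast] at h1
    have h2 : q = start s n k m + (k - y) := by omega
    rw [h2]
    exact h1
  · rcases Nat.eq_zero_or_pos m with rfl | hm0
    · rw [start_zero] at hq; omega
    · obtain ⟨i, rfl⟩ := Nat.exists_eq_succ_of_ne_zero hm0.ne'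
      rw [Nat.succ_eq_add_one] at *
      rw [start_succ hnk (by omega)] at hq
      obtain ⟨j, hj⟩ := Word.exists_isLastNonzero (maxWord_ne_zeroWord hnk
        (show i + 1 < numMax s n k by omega))
      have hlt := maxWord_lt hnk (Nat.lt_succ_self i) (show i + 1 < numMax s n k by omega)
      have hcons : ∀ N : Word s n, N.Maximal k → toLex N < toLex (maxWord s n k i) →
          toLex N ≤ toLex (maxWord s n k (i + 1)) := fun N hN h =>
        le_maxWord_succ hnk hN h (by omega)
      rw [Nat.succ_eq_add_one, hlast] at hlt
      rw [hlast] at hcons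
      have hjk := (maximal_maxWord hnk (by omega)).lt_of_consecutive_zeroWord hnk hlt hcons hj
      have h1 := hj.le_period_add (k := k) hnk
      have h2 : q = start s n k i + ((maxWord s n k i).period k - (y - k)) := by omega
      rw [h2, lyndonSeq, circ_start_add hnk (by omega) (by omega)]
      exact hj.per_period_sub hnk (by omega) (by omega)

theorem le_length_lyndonConcat (hs : 2 ≤ s) (hnk : k ∣ n ∨ n ∣ k) :
    n ≤ (lyndonConcat s n k).length := by
  rw [length_lyndonConcat hnk]
  calc n ≤ 2 ^ n := Nat.lt_two_pow_self.le
    _ ≤ s ^ n := Nat.pow_le_pow_left hs n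
    _ ≤ s ^ n * k := Nat.le_mul_of_pos_right _ (NeZero.pos k)

/-- If `M` is maximal and nonzero and `B` is its prefix of length `n - t`, then `0^t B` occurs at a
position congruent to `-t` modulo `k`: it straddles the start of the word that comes from the
greatest maximal word with prefix `B`, since the maximal word before that one ends with `0^t`. If
there is none before, then the end of the concatenation supplies the zeros. -/
theorem exists_occurrence_zeros_append (hs : 2 ≤ s) (hnk : k ∣ n ∨ n ∣ k) {M : Word s n}
    (hM : M.Maximal k) (h0 : M ≠ zeroWord s n) {t : ℕ} (ht : t ≤ n) :
    ∃ p, k ∣ p + t ∧ (∀ y < t, lyndonSeq s n k (p + y) = 0) ∧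
      ∀ y, t ≤ y → y < n → lyndonSeq s n k (p + y) = M.per (y - t) := by
  obtain ⟨a, ha, rfl⟩ := exists_maxWord_eq hnk hM
  have ha' := succ_lt_numMax hnk ha h0
  have hL := le_length_lyndonConcat hs hnk
  have hkL : k ∣ (lyndonConcat s n k).length := by
    rw [length_lyndonConcat hnk]; exact dvd_mul_left _ _
  have hex : ∃ g, ∀ y < n - t, (maxWord s n k g).per y = (maxWord s n k a).per y :=
    ⟨a, fun _ _ => rfl⟩
  obtain ⟨g, hg, hgmin, hga⟩ : ∃ g, (∀ y < n - t, (maxWord s n k g).per y =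
      (maxWord s n k a).per y) ∧ (∀ g' < g, ∃ y < n - t, (maxWord s n k g').per y ≠
      (maxWord s n k a).per y) ∧ g ≤ a := by
    refine ⟨Nat.find hex, Nat.find_spec hex, fun g' hg' => ?_, Nat.find_min' hex fun _ _ => rfl⟩
    have := Nat.find_min hex hg'
    push Not at this
    exact this
  refine ⟨start s n k g + (lyndonConcat s n k).length - t, ?_, fun y hy => ?_, fun y hty hyn => ?_⟩
  · rw [Nat.sub_add_cancel (by omega)]
    exact dvd_add (dvd_start hnk (by omega)) hkL
  · rcases Nat.eq_zero_or_pos g with rfl | hg0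
    · rw [start_zero]
      exact lyndonSeq_end hnk (y := t - y) (by omega) (by omega) (by omega)
    · obtain ⟨g, rfl⟩ := Nat.exists_eq_succ_of_ne_zero hg0.ne'
      rw [Nat.succ_eq_add_one] at *
      obtain ⟨e, he, hne⟩ := hgmin g (Nat.lt_succ_self g)
      obtain ⟨j, hj⟩ := Word.exists_isLastNonzero (maxWord_ne_zeroWord hnk
        (show g + 1 < numMax s n k by omega))
      have hje : j ≤ e := by
        by_contra! hej
        refine hne ?_
        rw [← hg e he]
        exact ((maximal_maxWord hnk (by omega)).agree_of_consecutive hnk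
          (maxWord_lt hnk (Nat.lt_succ_self g) (by omega))
          (fun N hN h => le_maxWord_succ hnk hN h (by omega)) hj e hej).symm
      have h1 := hj.le_period_add (k := k) hnk
      have h2 : start s n k (g + 1) + (lyndonConcat s n k).length - t + y =
          start s n k g + ((maxWord s n k g).period k - (t - y)) +
            (lyndonConcat s n k).length := by
        rw [start_succ hnk (by omega)]; omega
      rw [h2, lyndonSeq, circ_add_length, circ_start_add hnk (by omega) (by omega)]
      exact hj.per_period_sub hnk (by omega) (by omega)
  · have h2 : start s n k g + (lyndonConcat s n k).length - t + y =
        start s n k g + (y - t) + (lyndonConcat s n k).length := by omega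
    rw [h2, lyndonSeq, circ_add_length, ← lyndonSeq,
      lyndonSeq_start_add_of_lt hnk (by omega) (by omega)]
    exact hg _ (by omega)

/-- Every pair `⟨W, ρ⟩` occurs: `W` can be read at a position congruent to `ρ` modulo `k`. -/
theorem exists_occurrence (hs : 2 ≤ s) (hnk : k ∣ n ∨ n ∣ k) (W : Word s n) {ρ : ℕ} (hρ : ρ < k) :
    ∃ q, q % k = ρ ∧ window n (lyndonSeq s n k) q = W := by
  obtain ⟨M, hM, r, hr, hrρ, rfl⟩ := exists_maximal_rotation hnk W hρ
  have hmod : ∀ {p t : ℕ}, k ∣ p + t → k ∣ t + ρ → p % k = ρ := by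
    intro p t h1 h2
    have h3 : p + (t + ρ) ≡ ρ [MOD k] := by
      rw [← add_assoc]
      simpa using (Nat.modEq_zero_iff_dvd.2 h1).add_right ρ
    have h4 : p + (t + ρ) ≡ p [MOD k] := by
      simpa using (Nat.modEq_zero_iff_dvd.2 h2).add_left p
    have h5 := h4.symm.trans h3
    rwa [Nat.ModEq, Nat.mod_eq_of_lt hρ] at h5
  by_cases h0 : M = zeroWord s n
  · subst h0
    have hw : window n (zeroWord s n).per r = zeroWord s n := rfl
    rw [hw]
    -- `0 … 0` is read across the start of a word that begins with `n - t` zeros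
    have key : ∀ t ≤ n, k ∣ t + ρ → n < t + min k n →
        ∃ q, q % k = ρ ∧ window n (lyndonSeq s n k) q = zeroWord s n := by
      intro t ht h1 h2
      obtain ⟨j, hj⟩ : ∃ j : Fin n, (j : ℕ) + 1 = min k n :=
        ⟨⟨min k n - 1, by have := NeZero.pos n; omega⟩, by
          have := NeZero.pos n; have := NeZero.pos k; simp only; omega⟩
      have ha : (⟨1, hs⟩ : Fin s) ≠ 0 := fun h => by simpa using congrArg Fin.val h
      have hE := Word.maximal_single hnk ha j hj
      obtain ⟨p, hp1, hp2, hp3⟩ := exists_occurrence_zeros_append hs hnk hE (fun h => ha (by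
        rw [← Function.update_self j (⟨1, hs⟩ : Fin s) (zeroWord s n), h]; rfl)) ht
      refine ⟨p, hmod hp1 h1, funext fun y => ?_⟩
      change lyndonSeq s n k (p + y) = 0
      rcases lt_or_ge (y : ℕ) t with hyt | hyt
      · exact hp2 y hyt
      · have hy := y.2
        rw [hp3 y hyt hy, Word.per_of_lt _ (by omega), Function.update_of_ne]
        · rfl
        · intro h
          have := congrArg Fin.val h
          simp only at this
          omega
    rcases hnk with hkn | hkn
    · have hle : k ≤ n := Nat.le_of_dvd (NeZero.pos n) hkn
      refine key (n - ρ) (by omega) ?_ (by rw [min_eq_left hle]; omega)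
      rwa [Nat.sub_add_cancel (by omega)]
    · have hle : n ≤ k := Nat.le_of_dvd (NeZero.pos k) hkn
      rcases le_or_gt (ρ + n) k with h | h
      · have hpos := numMax_pos (s := s) (Or.inr hkn : k ∣ n ∨ n ∣ k)
        refine ⟨start s n k (numMax s n k - 1) + ρ, ?_, funext fun y => ?_⟩
        · rw [Nat.add_mod, Nat.mod_eq_zero_of_dvd (dvd_start (Or.inr hkn) (by omega)), zero_add,
            Nat.mod_mod, Nat.mod_eq_of_lt hρ]
        · change circ _ (_ + ρ + y) = _
          have hy := y.2
          rw [add_assoc, circ_start_add (Or.inr hkn) (by omega)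
            (by rw [Word.period_of_dvd hkn]; omega), maxWord_last (Or.inr hkn)]
          rfl
      · refine key (k - ρ) (by omega) ?_ (by rw [min_eq_right hle]; omega)
        rw [Nat.sub_add_cancel hρ.le]
  · obtain ⟨j, hj⟩ := Word.exists_isLastNonzero h0
    have hle := hj.le_period_add (k := k) hnk
    rcases le_or_gt (r + n) (M.period k + j) with h | h
    · obtain ⟨i, hi, rfl⟩ := exists_maxWord_eq hnk hM
      have hi' := succ_lt_numMax hnk hi h0
      refine ⟨start s n k i + r, ?_, funext fun y => ?_⟩
      · rw [Nat.add_mod, Nat.mod_eq_zero_of_dvd (dvd_start hnk hi.le), zero_add, Nat.mod_mod, hrρ]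
      · have hy := y.2
        change lyndonSeq s n k (_ + r + y) = Word.per _ (r + y)
        rw [add_assoc, lyndonSeq_start_add hnk hi' hj (by omega)]
    · obtain ⟨p, hp1, hp2, hp3⟩ := exists_occurrence_zeros_append hs hnk hM h0
        (t := M.period k - r) (by omega)
      refine ⟨p, hmod hp1 ?_, funext fun y => ?_⟩
      · rw [← hrρ]
        have h1 : M.period k - r + r % k + k * (r / k) = M.period k := by
          have := Nat.mod_add_div r k
          omega
        exact (Nat.dvd_add_left (dvd_mul_right k (r / k))).1 (by rw [h1]; exact M.dvd_period)
      · have hy := y.2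
        change lyndonSeq s n k (p + y) = M.per (r + y)
        rcases lt_or_ge (y : ℕ) (M.period k - r) with hyt | hyt
        · rw [hp2 y hyt]
          have h1 : r + y = M.period k - (M.period k - r - y) := by omega
          rw [h1, hj.per_period_sub hnk (by omega) (by omega)]
        · have h1 : r + y = y - (M.period k - r) + M.period k := by omega
          rw [hp3 y hyt hy, h1, M.periodic_period k]

end Agreement

/-! ### Perfect words -/

section Perfect

variable {s n k : ℕ} [NeZero n] [NeZero k] [NeZero s]

theorem mem_occurrences {v : List (Fin s)} {A : Word s n} {i : ℕ} :
    i ∈ occurrences v A ↔ i < v.length ∧ window n (circ v) i = A := by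
  simp only [occurrences, Finset.mem_filter, Finset.mem_range]
  refine and_congr_right fun hi => ?_
  have hpos : 0 < v.length := (Nat.zero_le i).trans_lt hi
  rw [funext_iff]
  refine forall_congr' fun j => ?_
  have hlt := Nat.mod_lt (i + j) hpos
  simp only [window, circ, List.getD_eq_getElem _ _ hlt, List.getElem?_eq_getElem hlt,
    Option.some.injEq]

/-- A word of length `s ^ n * k` in which every pair `⟨W, ρ⟩` occurs is perfect, by counting. -/
theorem perfect_of_surjective {v : List (Fin s)} (hv : v.length = s ^ n * k)
    (h : ∀ W : Word s n, ∀ ρ < k, ∃ q, q % k = ρ ∧ window n (circ v) q = W) (A : Word s n) :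
    (occurrences v A).card = k ∧ Set.InjOn (fun i : ℕ => i % k) (occurrences v A) := by
  have hkL : k ∣ v.length := by rw [hv]; exact dvd_mul_left _ _
  have hpos : 0 < v.length := by
    rw [hv]; exact Nat.mul_pos (pow_pos (NeZero.pos s) n) (NeZero.pos k)
  have h' : ∀ W : Word s n, ∀ ρ < k, ∃ q < v.length, q % k = ρ ∧ window n (circ v) q = W := by
    intro W ρ hρ
    obtain ⟨q, h1, h2⟩ := h W ρ hρ
    refine ⟨q % v.length, Nat.mod_lt _ hpos, by rw [Nat.mod_mod_of_dvd _ hkL, h1], ?_⟩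
    rw [← h2]
    refine window_eq_iff.2 fun i _ => ?_
    rw [← circ_mod, Nat.mod_add_mod, circ_mod]
  have hinj : Set.InjOn (fun q => (window n (circ v) q, q % k)) (Finset.range v.length) := by
    refine Finset.injOn_of_surjOn_of_card_le (t := (Finset.univ : Finset (Word s n)) ×ˢ
      Finset.range k) _ ?_ ?_ ?_
    · intro q _
      simpa using Nat.mod_lt _ (NeZero.pos k)
    · rintro ⟨W, ρ⟩ hW
      obtain ⟨q, h1, h2, h3⟩ := h' W ρ (by simpa using hW)
      exact ⟨q, by simpa using h1, by simp [h2, h3]⟩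
    · simp [hv]
  have hinjA : Set.InjOn (fun i : ℕ => i % k) (occurrences v A) := by
    intro q hq q' hq' hqq
    rw [Finset.mem_coe, mem_occurrences] at hq hq'
    exact hinj (by simpa using hq.1) (by simpa using hq'.1)
      (Prod.ext (hq.2.trans hq'.2.symm) hqq)
  refine ⟨?_, hinjA⟩
  rw [← Finset.card_image_of_injOn hinjA]
  have : (occurrences v A).image (fun i => i % k) = Finset.range k := by
    ext ρ
    simp only [Finset.mem_image, mem_occurrences, Finset.mem_range]
    constructor
    · rintro ⟨q, -, rfl⟩
      exact Nat.mod_lt _ (NeZero.pos k)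
    · intro hρ
      obtain ⟨q, h1, h2, h3⟩ := h' A ρ hρ
      exact ⟨q, ⟨h1, h3⟩, h2⟩
  rw [this, Finset.card_range]

theorem circ_rotate (v : List (Fin s)) (c q : ℕ) : circ (v.rotate c) q = circ v (q + c) := by
  rcases v.length.eq_zero_or_pos with h | h
  · rw [List.length_eq_zero_iff.1 h]; simp [circ]
  · have h1 := Nat.mod_lt q h
    have h2 := Nat.mod_lt (q + c) h
    rw [circ, circ, List.length_rotate, List.getD_eq_getElem _ _ (by simpa using h1),
      List.getD_eq_getElem _ _ h2, List.getElem_rotate]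
    simp [Nat.mod_add_mod]

theorem isPerfect_lyndonConcat (hs : 2 ≤ s) (hnk : k ∣ n ∨ n ∣ k) :
    IsPerfect n k (lyndonConcat s n k : Cycle (Fin s)) := by
  intro w hw A
  obtain ⟨c, rfl⟩ : lyndonConcat s n k ~r w := (Cycle.coe_eq_coe.1 hw).symm
  have hlen := length_lyndonConcat (s := s) hnk
  refine perfect_of_surjective (by rw [List.length_rotate, hlen]) (fun W ρ hρ => ?_) A
  obtain ⟨q, h1, h2⟩ := exists_occurrence hs hnk W (Nat.mod_lt (ρ + c) (NeZero.pos k))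
  -- `c` is subtracted from `q` after adding a multiple of the length
  have hL : 1 ≤ (lyndonConcat s n k).length :=
    (NeZero.pos n).trans_le (le_length_lyndonConcat hs hnk)
  have hcL : c ≤ c * (lyndonConcat s n k).length := Nat.le_mul_of_pos_right c hL
  refine ⟨q + c * (lyndonConcat s n k).length - c, ?_, ?_⟩
  · have h3 : q + c * (lyndonConcat s n k).length - c + c ≡ ρ + c [MOD k] := by
      rw [Nat.sub_add_cancel (by omega), hlen, ← mul_assoc, Nat.ModEq, Nat.add_mul_mod_self_right,
        h1]
    have h4 := Nat.ModEq.add_right_cancel' c h3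
    rwa [Nat.ModEq, Nat.mod_eq_of_lt hρ] at h4
  · rw [← h2]
    refine window_eq_iff.2 fun i _ => ?_
    have h3 : q + c * (lyndonConcat s n k).length - c + i + c =
        q + i + c * (lyndonConcat s n k).length := by omega
    rw [circ_rotate, h3, ← circ_mod, Nat.add_mul_mod_self_right, circ_mod]

end Perfect

/-! ### No perfect word is greater than the concatenation -/

section Greatest

variable {s n k : ℕ} [NeZero n] [NeZero k] [NeZero s]

theorem window_le_of_agree {x w : ℕ → Fin s} {i q : ℕ} (hagree : ∀ q < i, w q = x q)
    (hlt : x i < w i) (hqi : q ≤ i) : toLex (window n x q) ≤ toLex (window n w q) := by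
  rcases lt_or_ge i (q + n) with h | h
  · refine (window_lt_of_apply_lt (i - q) (by omega) (fun y hy => ?_) ?_).le
    · exact (hagree _ (by omega)).symm
    · rwa [Nat.add_sub_cancel' hqi]
  · refine le_of_eq (congrArg toLex (window_eq_iff.2 fun y hy => ?_))
    exact (hagree _ (by omega)).symm

/-- Let `w` agree with `x` before position `i` and have a greater letter there. Let `S` be an upward
closed set of words that all occur in `x` before position `p ≤ i`, in the residue class of `p`. Then
`w` has at least as many windows in `S` there, since they only grow, and one more at `p`. As `S` has
no room for it, windows in `w` must coincide. -/
theorem false_of_window_mem {x w : ℕ → Fin s} {i p : ℕ} {S : Set (Word s n)}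
    (hS : ∀ A B : Word s n, toLex A ≤ toLex B → A ∈ S → B ∈ S) (hagree : ∀ q < i, w q = x q)
    (hlt : x i < w i) (hpi : p ≤ i)
    (hocc : ∀ W ∈ S, ∃ q < p, q % k = p % k ∧ window n x q = W) (hp : window n w p ∈ S)
    (hinj : ∀ q ≤ p, ∀ q' ≤ p, q % k = q' % k → window n w q = window n w q' → q = q') :
    False := by
  classical
  let T : Finset ℕ := (Finset.range p).filter fun q => q % k = p % k ∧ window n x q ∈ S
  have h1 : S.toFinset.card ≤ T.card := by
    refine (Finset.card_le_card fun W hW => ?_).trans (Finset.card_image_le (f := window n x))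
    have hW' : W ∈ S := by simpa using hW
    obtain ⟨q, h1, h2, h3⟩ := hocc W hW'
    exact Finset.mem_image.2 ⟨q, by simp [T, h1, h2, h3, hW'], h3⟩
  have h2 : (insert p T).card = T.card + 1 := Finset.card_insert_of_notMem (by simp [T])
  have hmem : ∀ q ∈ insert p T, q ≤ p ∧ q % k = p % k ∧ window n w q ∈ S := by
    intro q hq
    rcases Finset.mem_insert.1 hq with rfl | hq
    · exact ⟨le_rfl, rfl, hp⟩
    · simp only [T, Finset.mem_filter, Finset.mem_range] at hq
      exact ⟨hq.1.le, hq.2.1,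
        hS _ _ (window_le_of_agree hagree hlt (hq.1.le.trans hpi)) hq.2.2⟩
  have h3 : (insert p T).card ≤ S.toFinset.card := by
    refine Finset.card_le_card_of_injOn (window n w) (fun q hq => ?_) fun q hq q' hq' h => ?_
    · simpa using (hmem q hq).2.2
    · obtain ⟨h4, h5, -⟩ := hmem q hq
      obtain ⟨h6, h7, -⟩ := hmem q' hq'
      exact hinj q h4 q' h6 (h5.trans h7.symm) h
  omega

/-- For `k ∣ n`: a word greater than a nonzero maximal word `M` occurs, at a position divisible by
`k`, before the word that comes from `M`. The occurrences of `exists_occurrence_zeros_append`, which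
might be at the very end, are not needed, since such a word would begin with `k` zeros. -/
theorem exists_occurrence_lt_of_dvd (hkn : k ∣ n) {h : ℕ} (hh : h + 1 < numMax s n k)
    {W : Word s n} (hW : toLex (maxWord s n k h) < toLex W) :
    ∃ q < start s n k h, q % k = 0 ∧ window n (lyndonSeq s n k) q = W := by
  have hnk : k ∣ n ∨ n ∣ k := Or.inl hkn
  obtain ⟨M, hM, r, hr, hrk, rfl⟩ := exists_maximal_rotation hnk W (NeZero.pos k)
  have hlt := hW.trans_le (hM r (Nat.dvd_of_mod_eq_zero hrk))
  have h0 : M ≠ zeroWord s n := by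
    rintro rfl
    exact absurd hlt (not_lt.2 (Word.zeroWord_le _))
  obtain ⟨g, hg, rfl⟩ := exists_maxWord_eq hnk hM
  have hgh : g < h := lt_of_maxWord_lt hnk hg hlt
  obtain ⟨j, hj⟩ := Word.exists_isLastNonzero h0
  have hle := hj.le_period_add (k := k) hnk
  rcases le_or_gt (r + n) ((maxWord s n k g).period k + j) with h1 | h1
  · refine ⟨start s n k g + r, ?_, ?_, funext fun y => ?_⟩
    · have h2 := start_succ hnk hg
      have h3 := start_mono (s := s) hnk (Nat.succ_le_of_lt hgh) (show h ≤ numMax s n k by omega)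
      rw [Nat.succ_eq_add_one] at h3
      omega
    · rw [Nat.add_mod, Nat.mod_eq_zero_of_dvd (dvd_start hnk hg.le), hrk]; simp
    · have hy := y.2
      change lyndonSeq s n k (_ + r + y) = Word.per _ (r + y)
      rw [add_assoc, lyndonSeq_start_add hnk (by omega) hj (by omega)]
  · exfalso
    have hkt : k ≤ (maxWord s n k g).period k - r :=
      Nat.le_of_dvd (by omega) (Nat.dvd_sub (Word.dvd_period _) (Nat.dvd_of_mod_eq_zero hrk))
    have hz : ∀ y < k, (maxWord s n k g).per (r + y) = 0 := fun y hy => by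
      have h2 : r + y = (maxWord s n k g).period k - ((maxWord s n k g).period k - r - y) := by
        omega
      rw [h2, hj.per_period_sub hnk (by omega) (by omega)]
    obtain ⟨e, he, h2, h3⟩ := Word.exists_of_lt hW
    have hke : k ≤ e := by
      by_contra! hek
      have h4 : window n (maxWord s n k g).per r ⟨e, he⟩ = 0 := hz e hek
      rw [h4] at h3
      exact (Fin.zero_le _).not_gt h3
    obtain ⟨y, hyk, hyn, hy⟩ :=
      (maximal_maxWord hnk (show h < numMax s n k by omega)).exists_ne_zero
        (maxWord_ne_zeroWord hnk hh)
    refine hy ?_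
    rw [Word.per_of_lt _ hyn, h2 y (by omega)]
    exact hz y hyk

theorem length_of_perfect {w : List (Fin s)}
    (hw : ∀ A : Word s n, (occurrences w A).card = k) : w.length = s ^ n * k := by
  classical
  have h1 := Finset.card_eq_sum_card_fiberwise (s := Finset.range w.length)
    (t := (Finset.univ : Finset (Word s n))) (f := window n (circ w)) fun _ _ => by simp
  rw [Finset.card_range] at h1
  rw [h1]
  have h2 : ∀ A : Word s n, ((Finset.range w.length).filter
      fun q => window n (circ w) q = A).card = k := fun A => by
    rw [← hw A]
    congr 1
    ext q
    rw [mem_occurrences]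
    simp
  simp [h2]

theorem not_lyndonConcat_lt (hs : 2 ≤ s) (hnk : k ∣ n ∨ n ∣ k) {w : List (Fin s)}
    (hw : ∀ A : Word s n,
      (occurrences w A).card = k ∧ Set.InjOn (fun i : ℕ => i % k) (occurrences w A)) :
    ¬ lyndonConcat s n k < w := by
  intro hlt
  have hlen : w.length = (lyndonConcat s n k).length := by
    rw [length_lyndonConcat hnk, length_of_perfect fun A => (hw A).1]
  obtain ⟨i, hi, hagree, hxi⟩ : ∃ i < (lyndonConcat s n k).length,
      (∀ q < i, circ w q = lyndonSeq s n k q) ∧ lyndonSeq s n k i < circ w i := by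
    have hc : ∀ (v : List (Fin s)) (q : ℕ) (hq : q < v.length), circ v q = v[q] := fun v q hq =>
      circ_of_getElem? (List.getElem?_eq_getElem hq)
    rcases List.lt_iff_exists.1 hlt with ⟨-, h⟩ | ⟨i, h1, h2, h3, h4⟩
    · omega
    · refine ⟨i, h1, fun q hq => ?_, ?_⟩
      · rw [hc _ _ (hq.trans h2), lyndonSeq, hc _ _ (hq.trans h1)]
        exact (h3 q hq).symm
      · rwa [lyndonSeq, hc _ _ h1, hc _ _ h2]
  have hinj : ∀ p ≤ i, ∀ q ≤ p, ∀ q' ≤ p, q % k = q' % k →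
      window n (circ w) q = window n (circ w) q' → q = q' := by
    intro p hp q hq q' hq' h1 h2
    exact (hw (window n (circ w) q')).2 (mem_occurrences.2 ⟨by omega, h2⟩)
      (mem_occurrences.2 ⟨by omega, rfl⟩) h1
  have hupper : ∀ M A B : Word s n, toLex A ≤ toLex B → A ∈ {W : Word s n | toLex M < toLex W} →
      B ∈ {W : Word s n | toLex M < toLex W} := fun M A B hAB hA => lt_of_lt_of_le hA hAB
  obtain ⟨h, hh, e, he, hie⟩ := exists_eq_start_add hnk hi
  by_cases hkn : k ∣ n
  · by_cases h0 : h + 1 < numMax s n k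
    · -- the words greater than the `h`-th maximal word are used up before its block
      have hper : (maxWord s n k h).period k ≤ n := by
        have h1 := (maxWord s n k h).period_dvd_max hnk
        rw [max_eq_left (Nat.le_of_dvd (NeZero.pos n) hkn)] at h1
        exact Nat.le_of_dvd (NeZero.pos n) h1
      refine false_of_window_mem (k := k) (hupper (maxWord s n k h)) hagree hxi
        (p := start s n k h) (by omega) (fun W hW => ?_) ?_ (hinj _ (by omega))
      · obtain ⟨q, h1, h2, h3⟩ := exists_occurrence_lt_of_dvd hkn h0 hW
        exact ⟨q, h1, by rw [h2, Nat.mod_eq_zero_of_dvd (dvd_start hnk hh.le)], h3⟩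
      · rw [Set.mem_ofPred_eq, ← window_per_zero (maxWord s n k h)]
        refine window_lt_of_apply_lt e (by omega) (fun y hy => ?_) ?_
        · rw [hagree _ (by omega), lyndonSeq_start_add_of_lt hnk h0 (by omega), zero_add]
        · rw [zero_add, ← lyndonSeq_start_add_of_lt hnk h0 (by omega), ← hie]
          exact hxi
    · -- in the last block, each residue occurs only once more
      have hL : (lyndonConcat s n k).length = start s n k h + k := by
        rw [← start_numMax, show numMax s n k = h + 1 by omega, start_succ hnk hh]
        have h1 := maxWord_last (s := s) hnk
        rw [show numMax s n k - 1 = h by omega] at h1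
        rw [h1, period_zeroWord hnk]
      refine false_of_window_mem (k := k) (S := {W : Word s n | circ w i ≤ W 0}) ?_ hagree hxi
        (p := i) le_rfl (fun W hW => ?_) ?_ (hinj _ le_rfl)
      · intro A B hAB hA
        exact le_trans hA (Pi.apply_le_of_toLex hAB fun j hj => absurd hj (Fin.not_lt_zero j))
      · obtain ⟨q, h1, h2⟩ := exists_occurrence hs hnk W (Nat.mod_lt i (NeZero.pos k))
        have hpos : 0 < (lyndonConcat s n k).length := by omega
        have hkL : k ∣ (lyndonConcat s n k).length := by
          rw [length_lyndonConcat hnk]; exact dvd_mul_left _ _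
        have hq := Nat.mod_lt q hpos
        have hqk : q % (lyndonConcat s n k).length % k = i % k := by
          rw [Nat.mod_mod_of_dvd _ hkL, h1]
        refine ⟨q % (lyndonConcat s n k).length, ?_, hqk, ?_⟩
        · by_contra! hiq
          have h3 : q % (lyndonConcat s n k).length = i := by
            have h4 := (Nat.modEq_iff_dvd' hiq).1 hqk.symm
            have h5 := Nat.eq_zero_of_dvd_of_lt h4 (by omega)
            omega
          have h4 : W 0 = lyndonSeq s n k i := by
            rw [← h2, ← h3, lyndonSeq, circ_mod]; simp [window]
          have h5 : circ w i ≤ W 0 := hW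
          rw [h4] at h5
          exact absurd hxi (not_lt.2 h5)
        · rw [← h2]
          refine window_eq_iff.2 fun y _ => ?_
          rw [lyndonSeq, ← circ_mod, Nat.mod_add_mod, circ_mod]
      · change circ w i ≤ circ w (i + ((0 : Fin n) : ℕ))
        simp
  · -- every word is maximal, and the blocks are powers of words
    have hnk' : n ∣ k := hnk.resolve_left hkn
    have hnle : n ≤ k := Nat.le_of_dvd (NeZero.pos k) hnk'
    rw [Word.period_of_dvd hnk'] at he
    have hmod := Nat.mod_lt e (NeZero.pos n)
    have hdm := Nat.div_add_mod e n
    have hbound : n * (e / n) + n ≤ k := by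
      obtain ⟨c, rfl⟩ := hnk'
      have : e / n < c := Nat.div_lt_of_lt_mul he
      calc n * (e / n) + n = n * (e / n + 1) := by ring
        _ ≤ n * c := Nat.mul_le_mul_left _ this
    have hread : ∀ g < numMax s n k, ∀ y < n,
        lyndonSeq s n k (start s n k g + n * (e / n) + y) = (maxWord s n k g).per y := by
      intro g hg y hy
      rw [add_assoc, lyndonSeq, circ_start_add hnk hg (by rw [Word.period_of_dvd hnk']; omega),
        add_comm, Word.per_add_of_dvd _ _ (dvd_mul_right _ _)]
    refine false_of_window_mem (k := k) (hupper (maxWord s n k h)) hagree hxi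
      (p := start s n k h + n * (e / n)) (by omega) (fun W hW => ?_) ?_ (hinj _ (by omega))
    · have hWmax : W.Maximal k := Word.maximal_of_lt hnk fun d _ hdn _ => by
        have : d = 0 := by omega
        rw [this, window_per_zero]
      obtain ⟨g, hg, rfl⟩ := exists_maxWord_eq hnk hWmax
      have hgh : g < h := lt_of_maxWord_lt hnk hg hW
      refine ⟨start s n k g + n * (e / n), ?_, ?_, ?_⟩
      · have h2 := start_succ hnk hg
        have h3 := start_mono (s := s) hnk (Nat.succ_le_of_lt hgh) hh.le
        rw [Nat.succ_eq_add_one] at h3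
        have h4 := (maxWord s n k g).period_pos (k := k) hnk
        omega
      · rw [Nat.add_mod, Nat.mod_eq_zero_of_dvd (dvd_start hnk hg.le), Nat.add_mod (start s n k h),
          Nat.mod_eq_zero_of_dvd (dvd_start hnk hh.le)]
      · rw [← window_per_zero (maxWord s n k g)]
        refine window_eq_iff.2 fun y hy => ?_
        rw [hread g hg y hy, zero_add]
    · rw [Set.mem_ofPred_eq, ← window_per_zero (maxWord s n k h)]
      refine window_lt_of_apply_lt (e % n) hmod (fun y hy => ?_) ?_
      · rw [hagree _ (by omega), hread h hh y (by omega), zero_add]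
      · rw [zero_add, ← hread h hh _ hmod, add_assoc, hdm, ← hie]
        exact hxi

theorem le_lyndonConcat_of_isPerfect (hs : 2 ≤ s) (hnk : k ∣ n ∨ n ∣ k) {w : List (Fin s)}
    (hw : IsPerfect n k (w : Cycle (Fin s))) : w ≤ lyndonConcat s n k :=
  not_lt.1 (not_lyndonConcat_lt hs hnk (hw w rfl))

theorem exists_isMaxRotation (c : Cycle (Fin s)) : ∃ w, IsMaxRotation w c := by
  induction c using Quotient.inductionOn with
  | h w =>
    have hfin : {v : List (Fin s) | (v : Cycle (Fin s)) = (w : Cycle (Fin s))}.Finite := by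
      refine (List.finite_toSet w.cyclicPermutations).subset fun v hv => ?_
      exact List.mem_cyclicPermutations_iff.2 (Cycle.coe_eq_coe.1 hv)
    obtain ⟨v, hv, hmax⟩ := hfin.exists_maximal ⟨w, rfl⟩
    exact ⟨v, hv, fun u hu => (le_total u v).elim id fun h => hmax hu h⟩

end Greatest

/-! ### Lyndon words -/

section Lyndon

variable {s n : ℕ} [NeZero n] [NeZero s]

theorem rotate_ofFn {f : ℕ → Fin s} {p : ℕ} (hf : f.Periodic p) (c : ℕ) :
    (List.ofFn (window p f 0)).rotate c = List.ofFn (window p f c) := by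
  refine List.ext_getElem (by simp) fun i h1 h2 => ?_
  rw [List.getElem_rotate]
  simp only [List.getElem_ofFn, window, List.length_ofFn]
  rw [zero_add, hf.map_mod_nat, add_comm]

theorem isLyndonWord_ofFn_iff {f : ℕ → Fin s} {p : ℕ} (hf : f.Periodic p) :
    IsLyndonWord (List.ofFn (window p f 0)) ↔
      0 < p ∧ ∀ i, 0 < i → i < p → toLex (window p f i) < toLex (window p f 0) := by
  simp only [IsLyndonWord, rotate_ofFn hf, ofFn_lt_ofFn_iff, List.length_ofFn]
  refine and_congr_left fun _ => ?_
  rw [← List.length_pos_iff, List.length_ofFn]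

theorem mem_lyndonPairWords {k : ℕ} [NeZero k] (hnk : k ∣ n ∨ n ∣ k) {w : List (Fin s)} :
    w ∈ lyndonPairWords s n k ↔
      ∃ M : Word s n, M.Maximal k ∧ w = List.ofFn (window (M.period k) M.per 0) := by
  have hw : ∀ M : Word s n, List.ofFn (window (M.period k) M.per 0) =
      List.ofFn fun r : Fin (M.period k) => M.per r := fun M =>
    congrArg List.ofFn (funext fun r => congrArg M.per (zero_add (r : ℕ)))
  constructor
  · intro h
    obtain ⟨i, hi, rfl⟩ := List.getElem_of_mem h
    rw [length_lyndonPairWords] at hi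
    exact ⟨_, maximal_maxWord hnk hi, by rw [hw, lyndonPairWords_getElem hnk hi]⟩
  · rintro ⟨M, hM, rfl⟩
    obtain ⟨i, hi, rfl⟩ := exists_maxWord_eq hnk hM
    rw [hw, ← lyndonPairWords_getElem hnk hi]
    exact List.getElem_mem _

theorem isLyndonWord_of_maximal {M : Word s n} (hM : M.Maximal 1) :
    IsLyndonWord (List.ofFn (window (M.period 1) M.per 0)) := by
  have hnk : 1 ∣ n ∨ n ∣ 1 := Or.inl (one_dvd n)
  have hper := M.periodic_period 1
  refine (isLyndonWord_ofFn_iff hper).2 ⟨M.period_pos hnk, fun i hi0 hi => ?_⟩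
  rcases (hM.window_le (one_dvd i)).eq_or_lt with h | h
  · -- a rotation that fixes `M` is a multiple of the period
    refine absurd (Nat.le_of_dvd hi0 (M.period_dvd (one_dvd i) fun q => ?_)) (not_le.2 hi)
    rw [add_comm, ← M.per_window, toLex.injective h, window_per_zero]
  · obtain ⟨j, hj, h1, h2⟩ := exists_of_window_lt h
    refine window_lt_of_apply_lt j ?_ h1 h2
    by_contra! hle
    obtain ⟨y, rfl⟩ := Nat.exists_eq_add_of_le hle
    have h3 := h1 y (by have := M.period_pos (k := 1) hnk; omega)
    have h4 : i + (M.period 1 + y) = i + y + M.period 1 := by ring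
    have h5 : 0 + (M.period 1 + y) = 0 + y + M.period 1 := by ring
    rw [h4, h5, hper, hper, h3] at h2
    exact lt_irrefl _ h2

theorem exists_maximal_of_isLyndonWord {w : List (Fin s)} (hw : IsLyndonWord w)
    (hn : w.length ∣ n) :
    ∃ M : Word s n, M.Maximal 1 ∧ w = List.ofFn (window (M.period 1) M.per 0) := by
  have hf : Function.Periodic (circ w) w.length := circ_add_length w
  have hofFn : List.ofFn (window w.length (circ w) 0) = w := by
    refine List.ext_getElem (by simp) fun i h1 h2 => ?_
    rw [List.getElem_ofFn]
    change circ w (0 + i) = _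
    rw [zero_add, circ_of_getElem? (List.getElem?_eq_getElem h2)]
  have hlyn := hw
  rw [← hofFn, isLyndonWord_ofFn_iff hf] at hlyn
  obtain ⟨hpos, hlyn⟩ := hlyn
  have hle : w.length ≤ n := Nat.le_of_dvd (NeZero.pos n) hn
  obtain ⟨M, hM⟩ : ∃ M : Word s n, M = window n (circ w) 0 := ⟨_, rfl⟩
  have hMper : M.per = circ w := by
    funext q
    rw [hM]
    change circ w (0 + q % n) = circ w q
    rw [zero_add, ← circ_mod, Nat.mod_mod_of_dvd _ hn, circ_mod]
  have hMmax : M.Maximal 1 := by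
    intro d _
    refine le_of_le_of_eq ?_ (congrArg toLex (window_per_zero M))
    rw [hMper]
    have hd : window n (circ w) d = window n (circ w) (d % w.length) :=
      window_eq_iff.2 fun i _ => by rw [← circ_mod w (d % _ + i), Nat.mod_add_mod, circ_mod]
    rw [hd]
    rcases Nat.eq_zero_or_pos (d % w.length) with h0 | h0
    · rw [h0]
    · obtain ⟨j, hj, h1, h2⟩ := exists_of_window_lt (hlyn _ h0 (Nat.mod_lt _ hpos))
      exact (window_lt_of_apply_lt j (hj.trans_le hle) h1 h2).le
  have hperiod : M.period 1 = w.length := by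
    have hdvd : M.period 1 ∣ w.length := M.period_dvd (one_dvd _) (by rw [hMper]; exact hf)
    refine (Nat.le_of_dvd hpos hdvd).eq_of_not_lt fun hlt => ?_
    have h1 := hlyn _ (M.period_pos (Or.inl (one_dvd n))) hlt
    have h2 : window w.length (circ w) (M.period 1) = window w.length (circ w) 0 :=
      window_eq_iff.2 fun i _ => by
        rw [← hMper, zero_add, add_comm, M.periodic_period 1]
    rw [h2] at h1
    exact lt_irrefl _ h1
  exact ⟨M, hMmax, by rw [hperiod, hMper, hofFn]⟩

theorem pairwise_lyndonPairWords {k : ℕ} [NeZero k] (hkn : k ∣ n) :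
    (lyndonPairWords s n k).Pairwise fun v w =>
      wordPow w (n / w.length) < wordPow v (n / v.length) := by
  have hnk : k ∣ n ∨ n ∣ k := Or.inl hkn
  have hpow : ∀ M : Word s n, wordPow (List.ofFn fun r : Fin (M.period k) => M.per r)
      (n / M.period k) = List.ofFn M := fun M => by
    have h1 := M.period_dvd_max hnk
    rw [max_eq_left (Nat.le_of_dvd (NeZero.pos n) hkn)] at h1
    rw [wordPow_ofFn (M.periodic_period k), Nat.div_mul_cancel h1, M.ofFn_per]
  rw [List.pairwise_iff_getElem]
  intro i j hi hj hij
  rw [length_lyndonPairWords] at hi hj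
  rw [lyndonPairWords_getElem hnk hi, lyndonPairWords_getElem hnk hj, List.length_ofFn,
    List.length_ofFn, hpow, hpow, ofFn_lt_ofFn_iff]
  exact maxWord_lt hnk hij hj

end Lyndon

theorem theorem1 (s n k : ℕ) (hs : 2 ≤ s) [NeZero n] [NeZero k] (hnk : k ∣ n ∨ n ∣ k) :
    (lyndonConcat s n k).length = s ^ n * k ∧
    IsPerfect n k (lyndonConcat s n k : Cycle (Fin s)) ∧
    IsMaxRotation (lyndonConcat s n k) (lyndonConcat s n k : Cycle (Fin s)) ∧
    (∀ c : Cycle (Fin s), IsPerfect n k c → c ≠ (lyndonConcat s n k : Cycle (Fin s)) →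
      NecklaceGT (lyndonConcat s n k : Cycle (Fin s)) c) ∧
    (k = 1 →
      (∀ w : List (Fin s), w ∈ lyndonPairWords s n k ↔ IsLyndonWord w ∧ w.length ∣ n) ∧
      (lyndonPairWords s n k).Pairwise fun v w =>
        wordPow w (n / w.length) < wordPow v (n / v.length)) := by
  have : NeZero s := ⟨by omega⟩
  have hperf := isPerfect_lyndonConcat hs hnk
  have hmax : IsMaxRotation (lyndonConcat s n k) (lyndonConcat s n k : Cycle (Fin s)) := by
    refine ⟨rfl, fun v hv => ?_⟩
    have hv' : (v : Cycle (Fin s)) = lyndonConcat s n k := hv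
    exact le_lyndonConcat_of_isPerfect hs hnk (by rw [hv']; exact hperf)
  refine ⟨length_lyndonConcat hnk, hperf, hmax, fun c hc hne => ?_, ?_⟩
  · obtain ⟨w, hw⟩ := exists_isMaxRotation c
    refine ⟨_, w, hmax, hw, ?_⟩
    have hwc : (w : Cycle (Fin s)) = c := hw.1
    refine lt_of_le_of_ne (le_lyndonConcat_of_isPerfect hs hnk (by rw [hwc]; exact hc)) ?_
    rintro rfl
    exact hne hwc.symm
  · rintro rfl
    refine ⟨fun w => ?_, pairwise_lyndonPairWords (one_dvd n)⟩
    rw [mem_lyndonPairWords hnk]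
    constructor
    · rintro ⟨M, hM, rfl⟩
      refine ⟨isLyndonWord_of_maximal hM, ?_⟩
      have h1 := M.period_dvd_max hnk
      rw [max_eq_left (NeZero.pos n)] at h1
      rwa [List.length_ofFn]
    · rintro ⟨h1, h2⟩
      exact exists_maximal_of_isLyndonWord h1 h2
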